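/- **Base.** Let $\mathcal S$ be a small category with binary products and an initial object $\emptyset$, and let $\mathcal S^{sm}$ ("smooth morphisms") and $\mathcal S^{cl}$ ("closed immersions") be subcategories containing all objects and all isomorphisms, such that: (1) for $p:P\to S$ smooth and any $f:T\to S$ the fibered product $P\times_S T$ exists, and any base change of a smooth morphism is smooth; (2) any base change of a closed immersion along a smooth morphism is a closed immersion, and if $g\circ z$ is a closed immersion, so is $z$; (3) every morphism factors as $p\circ t$ with $t$ a closed immersion and $p$ smooth; (4) for every closed immersion $z:Z\to S$ there is a smooth morphism $u:U\to S$ (the complementary open immersion) such that, for every $T$, composition with $u$ identifies $\mathrm{Hom}(T,U)$ with the set of those $f:T\to S$ for which $T\times_S Z=\emptyset$, i.e. the square with corners $\emptyset,T,Z,S$ is Cartesian; (5) if $z_1,z_2$ are closed immersions, so is $z_1\times z_2$. **Fibered category.** Let $\mathbb H$ be a triangulated $\mathcal S$-fibered category: triangulated categories $\mathbb H(S)$, triangulated functors $f^*:\mathbb H(S)\to\mathbb H(T)$ for $f:T\to S$, and coherent isomorphisms of triangulated functors $(gf)^*\cong f^*g^*$, $\mathrm{id}^*\cong\mathrm{id}$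 (treated as equalities below). Assume that $\mathbb H$ is localic: (a) $\mathbb H(\emptyset)=0$; (b) $p^*$ has a left adjoint $p_\#$ for every smooth $p$, and for every Cartesian square with sides $f':P_T\to P$, $p':P_T\to T$, $p:P\to S$ smooth, $f:T\to S$, the canonical map $p'_\#f'^*\to f^*p_\#$ is invertible; (c) $z^*$ has a fully faithful right adjoint $z_*$ for every closed immersion $z$; (d) the pair $(z^*,u^*)$ is conservative for every closed immersion $z$ with complementary open immersion $u$. **External tensor structures.** A triangulated external tensor structure $(\boxtimes,m)$ on $\mathbb H$ consists of triangulated bifunctors $\boxtimes:\mathbb H(S_1)\times\mathbb H(S_2)\to\mathbb H(S_1\times S_2)$ and, for all $f_i:T_i\to S_i$ ($i=1,2$), natural isomorphisms $m_{f_1,f_2}:f_1^*A_1\boxtimes f_2^*A_2\to(f_1\times f_2)^*(A_1\boxtimes A_2)$, compatible with shifts in each variable and with composition of morphisms in $\mathcal S$. A triangulated external tensor structure over $\mathcal S^{sm}$ is defined in the same way with $f_1,f_2$ restricted to smooth morphisms; one over $\mathcal S^{cl,op}$ for direct images has instead natural isomorphisms $\bar m_{z_1,z_2}:z_{1,*}A_1\boxtimes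 z_{2,*}A_2\to(z_1\times z_2)_*(A_1\boxtimes A_2)$ for closed immersions $z_1,z_2$, again compatible with shifts and composition. A structure over $\mathcal S$ or $\mathcal S^{sm}$ is called *smooth-adjointable* if, for all smooth $p_i:P_i\to S_i$, the map $$(p_1\times p_2)_\#(A_1\boxtimes A_2)\to(p_1\times p_2)_\#(p_1^*p_{1,\#}A_1\boxtimes p_2^*p_{2,\#}A_2)\xrightarrow{m}(p_1\times p_2)_\#(p_1\times p_2)^*(p_{1,\#}A_1\boxtimes p_{2,\#}A_2)\to p_{1,\#}A_1\boxtimes p_{2,\#}A_2$$ is invertible. A *localic* external tensor structure is a smooth-adjointable triangulated external tensor structure over $\mathcal S$. **Cores.** An *external tensor core* $(\boxtimes,m^{sm},\bar m^{cl})$ on $\mathbb H$ consists of a smooth-adjointable triangulated external tensor structure $(\boxtimes,m^{sm})$ over $\mathcal S^{sm}$ and a triangulated external tensor structure $(\boxtimes,\bar m^{cl})$ over $\mathcal S^{cl,op}$ for direct images, with the same $\boxtimes$, such that: * (C'-ETC-1) for all Cartesian squares with sides $z_i':P_{i,Z_i}\to P_i$, $p_i':P_{i,Z_i}\to Z_i$,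 $p_i:P_i\to S_i$ smooth, $z_i:Z_i\to S_i$ a closed immersion ($i=1,2$), the two composites $$p_1^*z_{1,*}A_1\boxtimes p_2^*z_{2,*}A_2\xrightarrow{m^{sm}}(p_1\times p_2)^*(z_{1,*}A_1\boxtimes z_{2,*}A_2)\xrightarrow{\bar m^{cl}}(p_1\times p_2)^*(z_1\times z_2)_*(A_1\boxtimes A_2)\to(z_1'\times z_2')_*(p_1'\times p_2')^*(A_1\boxtimes A_2)$$ and $$p_1^*z_{1,*}A_1\boxtimes p_2^*z_{2,*}A_2\to z'_{1,*}p_1'^*A_1\boxtimes z'_{2,*}p_2'^*A_2\xrightarrow{\bar m^{cl}}(z_1'\times z_2')_*(p_1'^*A_1\boxtimes p_2'^*A_2)\xrightarrow{m^{sm}}(z_1'\times z_2')_*(p_1'\times p_2')^*(A_1\boxtimes A_2)$$ agree, the unlabelled arrows being the canonical base change maps; * (T-ETS-1) for all $q_i=p_i\circ h_i$ with $p_i:P_i\to S_i$, $q_i:Q_i\to S_i$ smooth and $h_i:Q_i\to P_i$ a closed immersion ($i=1,2$), the isomorphism $m^{sm}_{q_1,q_2}$ equals the composite $$h_1^*p_1^*A_1\boxtimes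 h_2^*p_2^*A_2\xrightarrow{m^{cl}}(h_1\times h_2)^*(p_1^*A_1\boxtimes p_2^*A_2)\xrightarrow{m^{sm}}(h_1\times h_2)^*(p_1\times p_2)^*(A_1\boxtimes A_2),$$ where $m^{cl}$ is the inverse of the (automatically invertible) map $$(h_1\times h_2)^*(B_1\boxtimes B_2)\to(h_1\times h_2)^*(h_{1,*}h_1^*B_1\boxtimes h_{2,*}h_2^*B_2)\xrightarrow{\bar m^{cl}}(h_1\times h_2)^*(h_1\times h_2)_*(h_1^*B_1\boxtimes h_2^*B_2)\to h_1^*B_1\boxtimes h_2^*B_2.$$ **Theorem.** Every localic external tensor structure $(\boxtimes,m)$ on $\mathbb H$ determines by restriction and adjunction a unique external tensor core: its $m^{sm}$ is the restriction of $m$ to smooth morphisms and, for closed immersions $z_1,z_2$, its $\bar m^{cl}$ is the composite $$z_{1,*}A_1\boxtimes z_{2,*}A_2\to(z_1\times z_2)_*(z_1\times z_2)^*(z_{1,*}A_1\boxtimes z_{2,*}A_2)\xrightarrow{m^{-1}}(z_1\times z_2)_*(z_1^*z_{1,*}A_1\boxtimes z_2^*z_{2,*}A_2)\to(z_1\times z_2)_*(A_1\boxtimes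 A_2).$$ Conversely, every external tensor core on $\mathbb H$ is obtained in this way from exactly one localic external tensor structure, with the same $\boxtimes$. Thus localic external tensor structures and external tensor cores correspond bijectively. -/

import Mathlib

open CategoryTheory CategoryTheory.Limits

universe v u w' w

/-! ## Smooth morphisms and closed immersions -/

/-- `u : U ⟶ X` has the universal property of the open immersion complementary to `z : Z ⟶ X`:
composition with `u` identifies `Hom(T, U)` with the set of those `f : T ⟶ X` for which the square
with corners `∅, T, Z, X` is Cartesian. -/
def IsOpenComplement {S : Type u} [Category.{v} S] [HasInitial S] {Z X U : S}
    (z : Z ⟶ X) (u : U ⟶ X) : Prop :=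
  ∀ T : S, Function.Injective (fun a : T ⟶ U => a ≫ u) ∧
    ∀ f : T ⟶ X, (∃ a : T ⟶ U, a ≫ u = f) ↔ IsPullback (initial.to T) (initial.to Z) f z

/-- Two subcategories `sm` (smooth morphisms) and `cl` (closed immersions) of `S`, with all the
objects of `S` and all isomorphisms, satisfying the factorization axioms. -/
structure SmoothClosedPair (S : Type u) [Category.{v} S] where
  sm : MorphismProperty S
  cl : MorphismProperty S
  sm_comp : ∀ {X Y Z : S} (f : X ⟶ Y) (g : Y ⟶ Z), sm f → sm g → sm (f ≫ g)
  cl_comp : ∀ {X Y Z : S} (f : X ⟶ Y) (g : Y ⟶ Z), cl f → cl g → cl (f ≫ g)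
  sm_of_isIso : ∀ {X Y : S} (f : X ⟶ Y) [IsIso f], sm f
  cl_of_isIso : ∀ {X Y : S} (f : X ⟶ Y) [IsIso f], cl f
  hasPullback : ∀ {P X T : S} (p : P ⟶ X) (f : T ⟶ X), sm p → HasPullback p f
  sm_of_isPullback : ∀ {P X T P' : S} {f' : P' ⟶ P} {p' : P' ⟶ T} {p : P ⟶ X} {f : T ⟶ X},
    IsPullback f' p' p f → sm p → sm p'
  cl_of_isPullback : ∀ {P X Z P' : S} {z' : P' ⟶ P} {p' : P' ⟶ Z} {p : P ⟶ X} {z : Z ⟶ X},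
    IsPullback z' p' p z → sm p → cl z → cl z'
  cl_of_comp : ∀ {Z X V : S} (z : Z ⟶ X) (g : X ⟶ V), cl (z ≫ g) → cl z
  factor : ∀ {T X : S} (f : T ⟶ X), ∃ (P : S) (t : T ⟶ P) (p : P ⟶ X), cl t ∧ sm p ∧ t ≫ p = f

/-- A `SmoothClosedPair` with complementary open immersions, for which closed immersions are stable
under binary products (so that `cl`, like `sm`, is stable under `(f₁, f₂) ↦ f₁ × f₂`). -/
structure LocalicBase (S : Type u) [Category.{v} S] [HasBinaryProducts S] [HasInitial S] extends
    SmoothClosedPair S where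
  exists_complement : ∀ {Z X : S} (z : Z ⟶ X), cl z →
    ∃ (U : S) (u : U ⟶ X), sm u ∧ IsOpenComplement z u
  cl_prod : ∀ {T₁ X₁ T₂ X₂ : S} (z₁ : T₁ ⟶ X₁) (z₂ : T₂ ⟶ X₂), cl z₁ → cl z₂ →
    cl (prod.map z₁ z₂)

theorem isPullback_prodMap_id {S : Type u} [Category.{v} S] [HasBinaryProducts S]
    {T X : S} (f : T ⟶ X) (Y : S) :
    IsPullback (prod.fst : T ⨯ Y ⟶ T) (prod.map f (𝟙 Y)) f (prod.fst : X ⨯ Y ⟶ X) := by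
  refine ⟨⟨(prod.map_fst f (𝟙 Y)).symm⟩, ⟨PullbackCone.IsLimit.mk _
    (fun s => prod.lift s.fst (s.snd ≫ prod.snd)) ?_ ?_ ?_⟩⟩
  · intro s
    exact prod.lift_fst _ _
  · intro s
    apply Limits.prod.hom_ext
    · rw [Category.assoc, prod.map_fst, ← Category.assoc, prod.lift_fst, s.condition]
    · rw [Category.assoc, prod.map_snd, ← Category.assoc, prod.lift_snd, Category.comp_id]
  · intro s m h₁ h₂
    apply Limits.prod.hom_ext
    · rw [prod.lift_fst, h₁]
    · rw [prod.lift_snd, ← h₂, Category.assoc, prod.map_snd, Category.comp_id]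

theorem isPullback_id_prodMap {S : Type u} [Category.{v} S] [HasBinaryProducts S]
    {T X : S} (f : T ⟶ X) (Y : S) :
    IsPullback (prod.snd : Y ⨯ T ⟶ T) (prod.map (𝟙 Y) f) f (prod.snd : Y ⨯ X ⟶ X) := by
  refine ⟨⟨(prod.map_snd (𝟙 Y) f).symm⟩, ⟨PullbackCone.IsLimit.mk _
    (fun s => prod.lift (s.snd ≫ prod.fst) s.fst) ?_ ?_ ?_⟩⟩
  · intro s
    exact prod.lift_snd _ _
  · intro s
    apply Limits.prod.hom_ext
    · rw [Category.assoc, prod.map_fst, ← Category.assoc, prod.lift_fst, Category.comp_id]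
    · rw [Category.assoc, prod.map_snd, ← Category.assoc, prod.lift_snd, s.condition]
  · intro s m h₁ h₂
    apply Limits.prod.hom_ext
    · rw [prod.lift_fst, ← h₂, Category.assoc, prod.map_fst, Category.comp_id]
    · rw [prod.lift_snd, h₁]

/-- Smooth morphisms are stable under binary products. -/
theorem SmoothClosedPair.sm_prod {S : Type u} [Category.{v} S] [HasBinaryProducts S]
    (D : SmoothClosedPair S) {T₁ X₁ T₂ X₂ : S} (p₁ : T₁ ⟶ X₁) (p₂ : T₂ ⟶ X₂)
    (h₁ : D.sm p₁) (h₂ : D.sm p₂) : D.sm (prod.map p₁ p₂) := by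
  have h := D.sm_comp _ _ (D.sm_of_isPullback (isPullback_prodMap_id p₁ T₂) h₁)
    (D.sm_of_isPullback (isPullback_id_prodMap p₂ X₁) h₂)
  simpa using h

/-! ## Fibered categories -/

/-- An `S`-fibered category: inverse image functors `pull f = f^*` with connection isomorphisms
`(gf)^* ≅ f^* g^*`, coherent under triple composition and with coherent unit isomorphisms.
(Strict unitarity `id^* = id` is the case where `pullId` comes from an equality.)
The connection isomorphism takes the composite `k` together with a proof of `f ≫ g = k`. -/
structure FiberedCategory (S : Type u) [Category.{v} S] where
  fib : S → Type w
  [category : ∀ X, Category.{w'} (fib X)]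
  pull : ∀ {T X : S}, (T ⟶ X) → (fib X ⥤ fib T)
  pullId : ∀ X : S, pull (𝟙 X) ≅ 𝟭 (fib X)
  conn : ∀ {T X V : S} (f : T ⟶ X) (g : X ⟶ V) (k : T ⟶ V), f ≫ g = k →
    (pull k ≅ pull g ⋙ pull f)
  conn_assoc : ∀ {T X V W : S} (f : T ⟶ X) (g : X ⟶ V) (h : V ⟶ W) (fg : T ⟶ V) (gh : X ⟶ W)
    (k : T ⟶ W) (e₁ : f ≫ g = fg) (e₂ : g ≫ h = gh) (e₃ : f ≫ gh = k) (e₄ : fg ≫ h = k)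
    (A : fib W),
    (conn f gh k e₃).hom.app A ≫ (pull f).map ((conn g h gh e₂).hom.app A) =
      (conn fg h k e₄).hom.app A ≫ (conn f g fg e₁).hom.app ((pull h).obj A)
  conn_id_left : ∀ {T X : S} (f : T ⟶ X) (A : fib X),
    (conn (𝟙 T) f f (Category.id_comp f)).hom.app A ≫ (pullId T).hom.app ((pull f).obj A) = 𝟙 _
  conn_id_right : ∀ {T X : S} (f : T ⟶ X) (A : fib X),
    (conn f (𝟙 X) f (Category.comp_id f)).hom.app A ≫ (pull f).map ((pullId X).hom.app A) = 𝟙 _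

attribute [instance] FiberedCategory.category

/-- A triangulated `S`-fibered category: the fibers are triangulated categories, the inverse image
functors are triangulated, the structural isomorphisms are isomorphisms of triangulated functors. -/
class FiberedCategory.Triangulated {S : Type u} [Category.{v} S]
    (H : FiberedCategory.{v, u, w', w} S) where
  [preadditive : ∀ X, Preadditive (H.fib X)]
  [hasZeroObject : ∀ X, HasZeroObject (H.fib X)]
  [hasShift : ∀ X, HasShift (H.fib X) ℤ]
  [shift_additive : ∀ X (n : ℤ), (shiftFunctor (H.fib X) n).Additive]
  [pretriangulated : ∀ X, Pretriangulated (H.fib X)]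
  [isTriangulated : ∀ X, IsTriangulated (H.fib X)]
  [commShift : ∀ {T X : S} (f : T ⟶ X), (H.pull f).CommShift ℤ]
  [pull_isTriangulated : ∀ {T X : S} (f : T ⟶ X), (H.pull f).IsTriangulated]
  pullId_commShift : ∀ X : S, NatTrans.CommShift (H.pullId X).hom ℤ
  conn_commShift : ∀ {T X V : S} (f : T ⟶ X) (g : X ⟶ V) (k : T ⟶ V) (e : f ≫ g = k),
    NatTrans.CommShift (H.conn f g k e).hom ℤ

attribute [reducible] FiberedCategory.Triangulated.preadditive
  FiberedCategory.Triangulated.hasShift FiberedCategory.Triangulated.pretriangulated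
  FiberedCategory.Triangulated.commShift

attribute [instance] FiberedCategory.Triangulated.preadditive
  FiberedCategory.Triangulated.hasZeroObject FiberedCategory.Triangulated.hasShift
  FiberedCategory.Triangulated.shift_additive FiberedCategory.Triangulated.pretriangulated
  FiberedCategory.Triangulated.isTriangulated FiberedCategory.Triangulated.commShift
  FiberedCategory.Triangulated.pull_isTriangulated
  FiberedCategory.Triangulated.pullId_commShift FiberedCategory.Triangulated.conn_commShift

/-- A choice of left adjoints `left f = f_#` of the functors `f^*`, for `f` in `W`. -/
structure LeftAdjoints {S : Type u} [Category.{v} S] (H : FiberedCategory.{v, u, w', w} S)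
    (W : MorphismProperty S) where
  left : ∀ {T X : S} (f : T ⟶ X), W f → (H.fib T ⥤ H.fib X)
  adj : ∀ {T X : S} (f : T ⟶ X) (hf : W f), left f hf ⊣ H.pull f

/-- A choice of right adjoints `right f = f_*` of the functors `f^*`, for `f` in `W`. -/
structure RightAdjoints {S : Type u} [Category.{v} S] (H : FiberedCategory.{v, u, w', w} S)
    (W : MorphismProperty S) where
  right : ∀ {T X : S} (f : T ⟶ X), W f → (H.fib T ⥤ H.fib X)
  adj : ∀ {T X : S} (f : T ⟶ X) (hf : W f), H.pull f ⊣ right f hf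

section Adjoints

variable {S : Type u} [Category.{v} S] {H : FiberedCategory.{v, u, w', w} S}
  {W : MorphismProperty S}

/-- The direct image functors commute with the shift, by adjunction. -/
noncomputable instance RightAdjoints.commShift [H.Triangulated] (R : RightAdjoints H W)
    {T X : S} (f : T ⟶ X) (hf : W f) : (R.right f hf).CommShift ℤ :=
  (R.adj f hf).rightAdjointCommShift ℤ

/-- The connection isomorphism `(gf)_* ≅ g_* f_*`, adjoint to that of inverse images. -/
noncomputable def RightAdjoints.conn (R : RightAdjoints H W) {T X V : S} (f : T ⟶ X) (g : X ⟶ V)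
    (k : T ⟶ V) (e : f ≫ g = k) (hf : W f) (hg : W g) (hk : W k) :
    R.right k hk ≅ R.right f hf ⋙ R.right g hg :=
  conjugateIsoEquiv (R.adj k hk) ((R.adj g hg).comp (R.adj f hf)) (H.conn f g k e).symm

/-- For a commutative square `f' ≫ p = p' ≫ f`, the transformation
`p'_# f'^* ⟶ p'_# f'^* p^* p_# ≅ p'_# p'^* f^* p_# ⟶ f^* p_#`. -/
def LeftAdjoints.baseChange (L : LeftAdjoints H W) {P' P T X : S} (f' : P' ⟶ P) (p' : P' ⟶ T)
    (p : P ⟶ X) (f : T ⟶ X) (e : f' ≫ p = p' ≫ f) (hp : W p) (hp' : W p') (A : H.fib P) :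
    (L.left p' hp').obj ((H.pull f').obj A) ⟶ (H.pull f).obj ((L.left p hp).obj A) :=
  (L.left p' hp').map ((H.pull f').map ((L.adj p hp).unit.app A)) ≫
    (L.left p' hp').map ((H.conn f' p (p' ≫ f) e).inv.app ((L.left p hp).obj A) ≫
      (H.conn p' f (p' ≫ f) rfl).hom.app ((L.left p hp).obj A)) ≫
    (L.adj p' hp').counit.app ((H.pull f).obj ((L.left p hp).obj A))

/-- For a commutative square `z' ≫ p = p' ≫ z`, the transformation
`p^* z_* ⟶ z'_* z'^* p^* z_* ≅ z'_* p'^* z^* z_* ⟶ z'_* p'^*`. -/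
def RightAdjoints.baseChange (R : RightAdjoints H W) {P' P Z X : S} (z' : P' ⟶ P) (p' : P' ⟶ Z)
    (p : P ⟶ X) (z : Z ⟶ X) (e : z' ≫ p = p' ≫ z) (hz : W z) (hz' : W z') (A : H.fib Z) :
    (H.pull p).obj ((R.right z hz).obj A) ⟶ (R.right z' hz').obj ((H.pull p').obj A) :=
  (R.adj z' hz').unit.app ((H.pull p).obj ((R.right z hz).obj A)) ≫
    (R.right z' hz').map ((H.conn z' p (p' ≫ z) e).inv.app ((R.right z hz).obj A) ≫
      (H.conn p' z (p' ≫ z) rfl).hom.app ((R.right z hz).obj A)) ≫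
    (R.right z' hz').map ((H.pull p').map ((R.adj z hz).counit.app A))

end Adjoints

/-- A triangulated `S`-fibered category with left adjoints along smooth morphisms and right
adjoints along closed immersions is localic. -/
structure IsLocalic {S : Type u} [Category.{v} S] [HasBinaryProducts S] [HasInitial S]
    (D : LocalicBase S) (H : FiberedCategory.{v, u, w', w} S) [H.Triangulated]
    (L : LeftAdjoints H D.sm) (R : RightAdjoints H D.cl) : Prop where
  isZero : ∀ A : H.fib (⊥_ S), IsZero A
  isIso_baseChange : ∀ {P' P T X : S} {f' : P' ⟶ P} {p' : P' ⟶ T} {p : P ⟶ X} {f : T ⟶ X}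
    (sq : IsPullback f' p' p f) (hp : D.sm p) (hp' : D.sm p') (A : H.fib P),
    IsIso (L.baseChange f' p' p f sq.w hp hp' A)
  full : ∀ {Z X : S} (z : Z ⟶ X) (hz : D.cl z), (R.right z hz).Full
  faithful : ∀ {Z X : S} (z : Z ⟶ X) (hz : D.cl z), (R.right z hz).Faithful
  conservative : ∀ {Z X U : S} (z : Z ⟶ X) (u : U ⟶ X), D.cl z → D.sm u → IsOpenComplement z u →
    ∀ {A B : H.fib X} (φ : A ⟶ B), IsIso ((H.pull z).map φ) → IsIso ((H.pull u).map φ) → IsIso φ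

/-! ## External tensor structures -/

section Tensor

variable {S : Type u} [Category.{v} S] [HasBinaryProducts S]

/-- A family of triangulated bifunctors `box X₁ X₂ : H(X₁) × H(X₂) ⟶ H(X₁ × X₂)`, in curried
form. -/
structure ExternalProduct (H : FiberedCategory.{v, u, w', w} S) [H.Triangulated] where
  box : ∀ X₁ X₂ : S, H.fib X₁ ⥤ H.fib X₂ ⥤ H.fib (X₁ ⨯ X₂)
  [commShift : ∀ X₁ X₂ : S, (box X₁ X₂).CommShift₂Int]
  [isTriangulated_obj : ∀ (X₁ X₂ : S) (A₁ : H.fib X₁), ((box X₁ X₂).obj A₁).IsTriangulated]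
  [isTriangulated_flip : ∀ (X₁ X₂ : S) (A₂ : H.fib X₂),
    ((box X₁ X₂).flip.obj A₂).IsTriangulated]

attribute [instance] ExternalProduct.commShift ExternalProduct.isTriangulated_obj
  ExternalProduct.isTriangulated_flip

variable {H : FiberedCategory.{v, u, w', w} S} [H.Triangulated]

/-- The object `A₁ ⊠ A₂`. -/
noncomputable abbrev ExternalProduct.obj (B : ExternalProduct H) {X₁ X₂ : S} (A₁ : H.fib X₁) (A₂ : H.fib X₂) :
    H.fib (X₁ ⨯ X₂) :=
  ((B.box X₁ X₂).obj A₁).obj A₂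

/-- The morphism `φ₁ ⊠ φ₂`. -/
noncomputable abbrev ExternalProduct.map (B : ExternalProduct H) {X₁ X₂ : S} {A₁ B₁ : H.fib X₁}
    {A₂ B₂ : H.fib X₂} (φ₁ : A₁ ⟶ B₁) (φ₂ : A₂ ⟶ B₂) : B.obj A₁ A₂ ⟶ B.obj B₁ B₂ :=
  ((B.box X₁ X₂).map φ₁).app A₂ ≫ ((B.box X₁ X₂).obj B₁).map φ₂

/-- For functors `F₁`, `F₂`, `F` (thought of as images along `f₁`, `f₂`, `f₁ × f₂`), the data of a
natural isomorphism `F₁ A₁ ⊠ F₂ A₂ ≅ F (A₁ ⊠ A₂)` of bifunctors in `(A₁, A₂)`. -/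
noncomputable abbrev ExternalProduct.MonoidalityIso (B : ExternalProduct H) {X₁ X₂ Y₁ Y₂ : S}
    (F₁ : H.fib X₁ ⥤ H.fib Y₁) (F₂ : H.fib X₂ ⥤ H.fib Y₂)
    (F : H.fib (X₁ ⨯ X₂) ⥤ H.fib (Y₁ ⨯ Y₂)) :=
  F₁ ⋙ B.box Y₁ Y₂ ⋙ (Functor.whiskeringLeft _ _ _).obj F₂ ≅
    B.box X₁ X₂ ⋙ (Functor.whiskeringRight _ _ _).obj F

/-- Such a natural isomorphism is compatible with the shifts in each of the two variables. -/
structure ExternalProduct.MonoidalityIso.Triangulated {B : ExternalProduct H} {X₁ X₂ Y₁ Y₂ : S}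
    {F₁ : H.fib X₁ ⥤ H.fib Y₁} {F₂ : H.fib X₂ ⥤ H.fib Y₂}
    {F : H.fib (X₁ ⨯ X₂) ⥤ H.fib (Y₁ ⨯ Y₂)}
    [F₁.CommShift ℤ] [F₂.CommShift ℤ] [F.CommShift ℤ] (m : B.MonoidalityIso F₁ F₂ F) : Prop where
  commShift_right : ∀ A₁ : H.fib X₁,
    NatTrans.CommShift (F₁ := F₂ ⋙ (B.box Y₁ Y₂).obj (F₁.obj A₁))
      (F₂ := (B.box X₁ X₂).obj A₁ ⋙ F) (m.hom.app A₁) ℤ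
  commShift_left : ∀ A₂ : H.fib X₂,
    NatTrans.CommShift (F₁ := F₁ ⋙ (B.box Y₁ Y₂).flip.obj (F₂.obj A₂))
      (F₂ := (B.box X₁ X₂).flip.obj A₂ ⋙ F) (m.hom.flipApp A₂) ℤ

/-- The triangulated external tensor structures `(⊠, m)`, with given `⊠`, on the `W`-fibered
category underlying `H`. -/
@[ext]
structure ExternalTensorStructure (B : ExternalProduct H) (W : MorphismProperty S) where
  m : ∀ {T₁ X₁ T₂ X₂ : S} (f₁ : T₁ ⟶ X₁) (f₂ : T₂ ⟶ X₂), W f₁ → W f₂ →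
    B.MonoidalityIso (H.pull f₁) (H.pull f₂) (H.pull (prod.map f₁ f₂))
  triangulated : ∀ {T₁ X₁ T₂ X₂ : S} (f₁ : T₁ ⟶ X₁) (f₂ : T₂ ⟶ X₂) (h₁ : W f₁) (h₂ : W f₂),
    (m f₁ f₂ h₁ h₂).Triangulated
  m_comp : ∀ {T₁ X₁ V₁ T₂ X₂ V₂ : S} (f₁ : T₁ ⟶ X₁) (g₁ : X₁ ⟶ V₁) (k₁ : T₁ ⟶ V₁)
    (f₂ : T₂ ⟶ X₂) (g₂ : X₂ ⟶ V₂) (k₂ : T₂ ⟶ V₂) (e₁ : f₁ ≫ g₁ = k₁) (e₂ : f₂ ≫ g₂ = k₂)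
    (hf₁ : W f₁) (hg₁ : W g₁) (hk₁ : W k₁) (hf₂ : W f₂) (hg₂ : W g₂) (hk₂ : W k₂)
    (A₁ : H.fib V₁) (A₂ : H.fib V₂),
    ((m k₁ k₂ hk₁ hk₂).hom.app A₁).app A₂ ≫
        (H.conn (prod.map f₁ f₂) (prod.map g₁ g₂) (prod.map k₁ k₂)
          (by rw [prod.map_map, e₁, e₂])).hom.app (B.obj A₁ A₂) =
      B.map ((H.conn f₁ g₁ k₁ e₁).hom.app A₁) ((H.conn f₂ g₂ k₂ e₂).hom.app A₂) ≫
        ((m f₁ f₂ hf₁ hf₂).hom.app ((H.pull g₁).obj A₁)).app ((H.pull g₂).obj A₂) ≫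
          (H.pull (prod.map f₁ f₂)).map (((m g₁ g₂ hg₁ hg₂).hom.app A₁).app A₂)

/-- Restriction of an external tensor structure to a smaller class of morphisms. -/
noncomputable def ExternalTensorStructure.restrict {B : ExternalProduct H} {W W' : MorphismProperty S}
    (E : ExternalTensorStructure B W) (h : W' ≤ W) : ExternalTensorStructure B W' where
  m f₁ f₂ h₁ h₂ := E.m f₁ f₂ (h _ h₁) (h _ h₂)
  triangulated f₁ f₂ h₁ h₂ := E.triangulated f₁ f₂ (h _ h₁) (h _ h₂)
  m_comp f₁ g₁ k₁ f₂ g₂ k₂ e₁ e₂ hf₁ hg₁ hk₁ hf₂ hg₂ hk₂ A₁ A₂ :=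
    E.m_comp f₁ g₁ k₁ f₂ g₂ k₂ e₁ e₂ (h _ hf₁) (h _ hg₁) (h _ hk₁) (h _ hf₂) (h _ hg₂) (h _ hk₂)
      A₁ A₂

/-- Left-adjointability: for all `f₁, f₂` in `W` the transformation
`(f₁ × f₂)_#(A₁ ⊠ A₂) ⟶ (f₁ × f₂)_#(f₁^* f₁_# A₁ ⊠ f₂^* f₂_# A₂)
  ⟶ (f₁ × f₂)_# (f₁ × f₂)^*(f₁_# A₁ ⊠ f₂_# A₂) ⟶ f₁_# A₁ ⊠ f₂_# A₂` is invertible. -/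
def ExternalTensorStructure.IsLeftAdjointable {B : ExternalProduct H} {W : MorphismProperty S}
    (E : ExternalTensorStructure B W) (L : LeftAdjoints H W)
    (hW : ∀ {T₁ X₁ T₂ X₂ : S} (f₁ : T₁ ⟶ X₁) (f₂ : T₂ ⟶ X₂), W f₁ → W f₂ → W (prod.map f₁ f₂)) :
    Prop :=
  ∀ {T₁ X₁ T₂ X₂ : S} (f₁ : T₁ ⟶ X₁) (f₂ : T₂ ⟶ X₂) (h₁ : W f₁) (h₂ : W f₂)
    (A₁ : H.fib T₁) (A₂ : H.fib T₂),
    IsIso ((L.left (prod.map f₁ f₂) (hW f₁ f₂ h₁ h₂)).map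
        (B.map ((L.adj f₁ h₁).unit.app A₁) ((L.adj f₂ h₂).unit.app A₂)) ≫
      (L.left (prod.map f₁ f₂) (hW f₁ f₂ h₁ h₂)).map
        (((E.m f₁ f₂ h₁ h₂).hom.app ((L.left f₁ h₁).obj A₁)).app ((L.left f₂ h₂).obj A₂)) ≫
      (L.adj (prod.map f₁ f₂) (hW f₁ f₂ h₁ h₂)).counit.app
        (B.obj ((L.left f₁ h₁).obj A₁) ((L.left f₂ h₂).obj A₂)))

variable [HasInitial S]

/-- The triangulated external tensor structures `(⊠, m̄)`, with given `⊠`, on the fibered category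
over the opposite of the category of closed immersions given by the direct images `z_*`. -/
@[ext]
structure DirectImageTensorStructure (D : LocalicBase S) (B : ExternalProduct H)
    (R : RightAdjoints H D.cl) where
  m : ∀ {T₁ X₁ T₂ X₂ : S} (z₁ : T₁ ⟶ X₁) (z₂ : T₂ ⟶ X₂) (h₁ : D.cl z₁) (h₂ : D.cl z₂),
    B.MonoidalityIso (R.right z₁ h₁) (R.right z₂ h₂)
      (R.right (prod.map z₁ z₂) (D.cl_prod z₁ z₂ h₁ h₂))
  triangulated : ∀ {T₁ X₁ T₂ X₂ : S} (z₁ : T₁ ⟶ X₁) (z₂ : T₂ ⟶ X₂) (h₁ : D.cl z₁)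
    (h₂ : D.cl z₂), (m z₁ z₂ h₁ h₂).Triangulated
  m_comp : ∀ {T₁ X₁ V₁ T₂ X₂ V₂ : S} (f₁ : T₁ ⟶ X₁) (g₁ : X₁ ⟶ V₁) (k₁ : T₁ ⟶ V₁)
    (f₂ : T₂ ⟶ X₂) (g₂ : X₂ ⟶ V₂) (k₂ : T₂ ⟶ V₂) (e₁ : f₁ ≫ g₁ = k₁) (e₂ : f₂ ≫ g₂ = k₂)
    (hf₁ : D.cl f₁) (hg₁ : D.cl g₁) (hk₁ : D.cl k₁) (hf₂ : D.cl f₂) (hg₂ : D.cl g₂)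
    (hk₂ : D.cl k₂) (A₁ : H.fib T₁) (A₂ : H.fib T₂),
    ((m k₁ k₂ hk₁ hk₂).hom.app A₁).app A₂ ≫
        (R.conn (prod.map f₁ f₂) (prod.map g₁ g₂) (prod.map k₁ k₂)
          (by rw [prod.map_map, e₁, e₂]) (D.cl_prod _ _ hf₁ hf₂) (D.cl_prod _ _ hg₁ hg₂)
          (D.cl_prod _ _ hk₁ hk₂)).hom.app (B.obj A₁ A₂) =
      B.map ((R.conn f₁ g₁ k₁ e₁ hf₁ hg₁ hk₁).hom.app A₁)
          ((R.conn f₂ g₂ k₂ e₂ hf₂ hg₂ hk₂).hom.app A₂) ≫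
        ((m g₁ g₂ hg₁ hg₂).hom.app ((R.right f₁ hf₁).obj A₁)).app ((R.right f₂ hf₂).obj A₂) ≫
          (R.right (prod.map g₁ g₂) (D.cl_prod _ _ hg₁ hg₂)).map
            (((m f₁ f₂ hf₁ hf₂).hom.app A₁).app A₂)

/-- The transformation
`z₁_* A₁ ⊠ z₂_* A₂ ⟶ z₁₂_* z₁₂^*(z₁_* A₁ ⊠ z₂_* A₂) ≅ z₁₂_*(z₁^* z₁_* A₁ ⊠ z₂^* z₂_* A₂)
  ⟶ z₁₂_*(A₁ ⊠ A₂)` induced by `m`, where `z₁₂ = z₁ × z₂`. -/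
noncomputable def ExternalTensorStructure.rightMate {D : LocalicBase S} {B : ExternalProduct H}
    {W : MorphismProperty S} (E : ExternalTensorStructure B W) (hW : D.cl ≤ W)
    (R : RightAdjoints H D.cl) {Z₁ X₁ Z₂ X₂ : S} (z₁ : Z₁ ⟶ X₁) (z₂ : Z₂ ⟶ X₂)
    (h₁ : D.cl z₁) (h₂ : D.cl z₂) (A₁ : H.fib Z₁) (A₂ : H.fib Z₂) :
    B.obj ((R.right z₁ h₁).obj A₁) ((R.right z₂ h₂).obj A₂) ⟶
      (R.right (prod.map z₁ z₂) (D.cl_prod z₁ z₂ h₁ h₂)).obj (B.obj A₁ A₂) :=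
  (R.adj (prod.map z₁ z₂) (D.cl_prod z₁ z₂ h₁ h₂)).unit.app
      (B.obj ((R.right z₁ h₁).obj A₁) ((R.right z₂ h₂).obj A₂)) ≫
    (R.right (prod.map z₁ z₂) (D.cl_prod z₁ z₂ h₁ h₂)).map
      (((E.m z₁ z₂ (hW _ h₁) (hW _ h₂)).inv.app ((R.right z₁ h₁).obj A₁)).app
        ((R.right z₂ h₂).obj A₂)) ≫
    (R.right (prod.map z₁ z₂) (D.cl_prod z₁ z₂ h₁ h₂)).map
      (B.map ((R.adj z₁ h₁).counit.app A₁) ((R.adj z₂ h₂).counit.app A₂))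

/-- The transformation
`z₁₂^*(A₁ ⊠ A₂) ⟶ z₁₂^*(z₁_* z₁^* A₁ ⊠ z₂_* z₂^* A₂) ≅ z₁₂^* z₁₂_*(z₁^* A₁ ⊠ z₂^* A₂)
  ⟶ z₁^* A₁ ⊠ z₂^* A₂` induced by `m̄`, where `z₁₂ = z₁ × z₂`. -/
noncomputable def DirectImageTensorStructure.leftMate {D : LocalicBase S} {B : ExternalProduct H}
    {R : RightAdjoints H D.cl} (M : DirectImageTensorStructure D B R)
    {Z₁ X₁ Z₂ X₂ : S} (z₁ : Z₁ ⟶ X₁) (z₂ : Z₂ ⟶ X₂)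
    (h₁ : D.cl z₁) (h₂ : D.cl z₂) (A₁ : H.fib X₁) (A₂ : H.fib X₂) :
    (H.pull (prod.map z₁ z₂)).obj (B.obj A₁ A₂) ⟶
      B.obj ((H.pull z₁).obj A₁) ((H.pull z₂).obj A₂) :=
  (H.pull (prod.map z₁ z₂)).map
      (B.map ((R.adj z₁ h₁).unit.app A₁) ((R.adj z₂ h₂).unit.app A₂)) ≫
    (H.pull (prod.map z₁ z₂)).map
      (((M.m z₁ z₂ h₁ h₂).hom.app ((H.pull z₁).obj A₁)).app ((H.pull z₂).obj A₂)) ≫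
    (R.adj (prod.map z₁ z₂) (D.cl_prod z₁ z₂ h₁ h₂)).counit.app
      (B.obj ((H.pull z₁).obj A₁) ((H.pull z₂).obj A₂))

/-- The localic external tensor structures `(⊠, m)` on `H`, with given `⊠`: the triangulated
external tensor structures over all of `S` that are left-adjointable along smooth morphisms. -/
@[ext]
structure LocalicTensorStructure (D : LocalicBase S) (B : ExternalProduct H)
    (L : LeftAdjoints H D.sm) where
  toStr : ExternalTensorStructure B (⊤ : MorphismProperty S)
  smoothAdjointable : (toStr.restrict (W' := D.sm) le_top).IsLeftAdjointable L D.sm_prod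

/-- The external tensor cores `(⊠, m^sm, m̄^cl)` on `H`, with given `⊠`. The isomorphism
`h₁^* B₁ ⊠ h₂^* B₂ ≅ h₁₂^*(B₁ ⊠ B₂)` which `m̄^cl` determines along closed immersions `h₁, h₂` is
the inverse of `leftMate`; in `triangle` the diagram is written with its horizontal arrows reversed,
so that `leftMate` itself appears. -/
@[ext]
structure ExternalTensorCore (D : LocalicBase S) (B : ExternalProduct H)
    (L : LeftAdjoints H D.sm) (R : RightAdjoints H D.cl) where
  sm : ExternalTensorStructure B D.sm
  cl : DirectImageTensorStructure D B R
  smoothAdjointable : sm.IsLeftAdjointable L D.sm_prod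
  exchange : ∀ {P₁' P₁ Z₁ X₁ P₂' P₂ Z₂ X₂ : S}
    {z₁' : P₁' ⟶ P₁} {p₁' : P₁' ⟶ Z₁} {p₁ : P₁ ⟶ X₁} {z₁ : Z₁ ⟶ X₁}
    {z₂' : P₂' ⟶ P₂} {p₂' : P₂' ⟶ Z₂} {p₂ : P₂ ⟶ X₂} {z₂ : Z₂ ⟶ X₂}
    (sq₁ : IsPullback z₁' p₁' p₁ z₁) (sq₂ : IsPullback z₂' p₂' p₂ z₂)
    (hp₁ : D.sm p₁) (hz₁ : D.cl z₁) (hp₂ : D.sm p₂) (hz₂ : D.cl z₂)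
    (A₁ : H.fib Z₁) (A₂ : H.fib Z₂),
    have hp₁' : D.sm p₁' := D.sm_of_isPullback sq₁ hp₁
    have hz₁' : D.cl z₁' := D.cl_of_isPullback sq₁ hp₁ hz₁
    have hp₂' : D.sm p₂' := D.sm_of_isPullback sq₂ hp₂
    have hz₂' : D.cl z₂' := D.cl_of_isPullback sq₂ hp₂ hz₂
    ((sm.m p₁ p₂ hp₁ hp₂).hom.app ((R.right z₁ hz₁).obj A₁)).app ((R.right z₂ hz₂).obj A₂) ≫
        (H.pull (prod.map p₁ p₂)).map (((cl.m z₁ z₂ hz₁ hz₂).hom.app A₁).app A₂) ≫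
          R.baseChange (prod.map z₁' z₂') (prod.map p₁' p₂') (prod.map p₁ p₂) (prod.map z₁ z₂)
            (by rw [prod.map_map, prod.map_map, sq₁.w, sq₂.w])
            (D.cl_prod z₁ z₂ hz₁ hz₂) (D.cl_prod z₁' z₂' hz₁' hz₂') (B.obj A₁ A₂) =
      B.map (R.baseChange z₁' p₁' p₁ z₁ sq₁.w hz₁ hz₁' A₁)
          (R.baseChange z₂' p₂' p₂ z₂ sq₂.w hz₂ hz₂' A₂) ≫
        ((cl.m z₁' z₂' hz₁' hz₂').hom.app ((H.pull p₁').obj A₁)).app ((H.pull p₂').obj A₂) ≫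
          (R.right (prod.map z₁' z₂') (D.cl_prod z₁' z₂' hz₁' hz₂')).map
            (((sm.m p₁' p₂' hp₁' hp₂').hom.app A₁).app A₂)
  triangle : ∀ {Q₁ P₁ X₁ Q₂ P₂ X₂ : S}
    (h₁ : Q₁ ⟶ P₁) (p₁ : P₁ ⟶ X₁) (q₁ : Q₁ ⟶ X₁) (e₁ : h₁ ≫ p₁ = q₁)
    (h₂ : Q₂ ⟶ P₂) (p₂ : P₂ ⟶ X₂) (q₂ : Q₂ ⟶ X₂) (e₂ : h₂ ≫ p₂ = q₂)
    (hh₁ : D.cl h₁) (hp₁ : D.sm p₁) (hq₁ : D.sm q₁)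
    (hh₂ : D.cl h₂) (hp₂ : D.sm p₂) (hq₂ : D.sm q₂) (A₁ : H.fib X₁) (A₂ : H.fib X₂),
    (H.conn (prod.map h₁ h₂) (prod.map p₁ p₂) (prod.map q₁ q₂)
          (by rw [prod.map_map, e₁, e₂])).inv.app (B.obj A₁ A₂) ≫
        ((sm.m q₁ q₂ hq₁ hq₂).inv.app A₁).app A₂ ≫
          B.map ((H.conn h₁ p₁ q₁ e₁).hom.app A₁) ((H.conn h₂ p₂ q₂ e₂).hom.app A₂) =
      (H.pull (prod.map h₁ h₂)).map (((sm.m p₁ p₂ hp₁ hp₂).inv.app A₁).app A₂) ≫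
        cl.leftMate h₁ h₂ hh₁ hh₂ ((H.pull p₁).obj A₁) ((H.pull p₂).obj A₂)

/-- The core `C` is obtained from `E` by restriction (`m^sm` is the restriction of `m` to smooth
morphisms) and adjunction (`m̄^cl` is the right mate of `m` along closed immersions). -/
structure ExternalTensorCore.IsInducedBy {D : LocalicBase S} {B : ExternalProduct H}
    {L : LeftAdjoints H D.sm} {R : RightAdjoints H D.cl} (C : ExternalTensorCore D B L R)
    (E : LocalicTensorStructure D B L) : Prop where
  sm_eq : C.sm = E.toStr.restrict le_top
  cl_eq : ∀ {Z₁ X₁ Z₂ X₂ : S} (z₁ : Z₁ ⟶ X₁) (z₂ : Z₂ ⟶ X₂) (h₁ : D.cl z₁) (h₂ : D.cl z₂)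
    (A₁ : H.fib Z₁) (A₂ : H.fib Z₂),
    ((C.cl.m z₁ z₂ h₁ h₂).hom.app A₁).app A₂ = E.toStr.rightMate le_top R z₁ z₂ h₁ h₂ A₁ A₂

end Tensor

/-! ## Gluing labels along factorizations -/

/-! For a closed immersion, a monoidality isomorphism of inverse images and one of direct images are
mates: each is the transpose of the inverse of the other under `z^* ⊣ z_*`. They carry the same
information once the transposes in question are invertible.

Invertibility is geometric. Let `u : U ⟶ X` be complementary to `z : Z ⟶ X`. Base change and `H(∅) =
0` give `z^* u_# = 0` and `u^* z_* = 0`; by conservativity an object killed by `z^*` has the form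
`u_# B`, and one killed by `u^*` has the form `z_* B`. Given `m` over all of `S`, the object `z₁_*
A₁ ⊠ z₂_* A₂` therefore lies in the image of `(z₁ × z₂)_*`, so the right mate is invertible
(`isIso_rightMateApp`). Given only a core, smooth-adjointability shows that `A ⊠ A'` is killed by
`(z × 𝟙)^*` whenever `z^* A = 0`; passing to cones, `(z₁ × z₂)^*` inverts the product of the units,
so the left mate is invertible (`isIso_leftMateApp`).

Transposition also matches the axioms. Compatibility of `m̄` with composition becomes that of `m`
along closed immersions, `exchange` becomes the equality of the two composites around a Cartesian
square, and `triangle` says that `m` at `h` composed with `m` at `p` is `m` at `q`. All three are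
instances of `m_comp`, which gives the core of a localic structure.

Conversely, `m` has to be glued from its values on closed immersions and smooth morphisms: factor `f
= t ≫ p` and compose the two values. Independence of the factorization and compatibility with
composition use only associativity and the three identities, so this is done for abstract labels
(`exists_extension`), later applied to pairs of morphisms, that is, to `S × S`. The same
factorization gives uniqueness. -/

/-- A family of labels on the morphisms of a category, with an associative composition. -/
structure MorphismLabels (C : Type u) [Category.{v} C] where
  Label : ∀ {T X : C}, (T ⟶ X) → Type w
  comp : ∀ {T X V : C} (f : T ⟶ X) (g : X ⟶ V) (k : T ⟶ V), f ≫ g = k →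
    Label f → Label g → Label k
  assoc : ∀ {T X V W : C} (f : T ⟶ X) (g : X ⟶ V) (h : V ⟶ W) (fg : T ⟶ V) (gh : X ⟶ W)
    (k : T ⟶ W) (e₁ : f ≫ g = fg) (e₂ : g ≫ h = gh) (e₃ : f ≫ gh = k) (e₄ : fg ≫ h = k)
    (μ : Label f) (ν : Label g) (ρ : Label h),
    comp fg h k e₄ (comp f g fg e₁ μ ν) ρ = comp f gh k e₃ μ (comp g h gh e₂ ν ρ)

/-- Composable choices of labels on two classes of morphisms `cl` and `sm`, compatible with
base change of `sm` along `cl` and with the factorizations `h ≫ p = q`, where `h` is in `cl`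
and `p`, `q` are in `sm`. -/
structure MorphismLabels.GluingDatum {C : Type u} [Category.{v} C] (M : MorphismLabels.{v, u, w} C)
    (cl sm : MorphismProperty C) where
  c : ∀ {T X : C} (f : T ⟶ X), cl f → M.Label f
  s : ∀ {T X : C} (f : T ⟶ X), sm f → M.Label f
  c_comp : ∀ {T X V : C} (f : T ⟶ X) (g : X ⟶ V) (k : T ⟶ V) (e : f ≫ g = k) (hf : cl f)
    (hg : cl g) (hk : cl k), M.comp f g k e (c f hf) (c g hg) = c k hk
  s_comp : ∀ {T X V : C} (f : T ⟶ X) (g : X ⟶ V) (k : T ⟶ V) (e : f ≫ g = k) (hf : sm f)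
    (hg : sm g) (hk : sm k), M.comp f g k e (s f hf) (s g hg) = s k hk
  triangle : ∀ {Q P X : C} (h : Q ⟶ P) (p : P ⟶ X) (q : Q ⟶ X) (e : h ≫ p = q) (hh : cl h)
    (hp : sm p) (hq : sm q), M.comp h p q e (c h hh) (s p hp) = s q hq
  sm_id : ∀ X : C, sm (𝟙 X)
  cl_id : ∀ X : C, cl (𝟙 X)
  -- Labels have no units of their own, so those of the identities are required to be neutral
  -- against every label.
  s_id_left : ∀ {T X : C} (f : T ⟶ X) (μ : M.Label f),
    M.comp (𝟙 T) f f (Category.id_comp f) (s (𝟙 T) (sm_id T)) μ = μ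
  s_id_right : ∀ {T X : C} (f : T ⟶ X) (μ : M.Label f),
    M.comp f (𝟙 X) f (Category.comp_id f) μ (s (𝟙 X) (sm_id X)) = μ
  c_id_left : ∀ {T X : C} (f : T ⟶ X) (μ : M.Label f),
    M.comp (𝟙 T) f f (Category.id_comp f) (c (𝟙 T) (cl_id T)) μ = μ
  cl_comp : ∀ {X Y Z : C} (f : X ⟶ Y) (g : Y ⟶ Z), cl f → cl g → cl (f ≫ g)
  sm_comp : ∀ {X Y Z : C} (f : X ⟶ Y) (g : Y ⟶ Z), sm f → sm g → sm (f ≫ g)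
  cl_of_comp : ∀ {X Y Z : C} (f : X ⟶ Y) (g : Y ⟶ Z), cl (f ≫ g) → cl f
  factor : ∀ {T X : C} (f : T ⟶ X), ∃ (P : C) (t : T ⟶ P) (p : P ⟶ X), cl t ∧ sm p ∧ t ≫ p = f
  exists_baseChange : ∀ {P X T : C} (p : P ⟶ X) (f : T ⟶ X) (hp : sm p),
    ∃ (P' : C) (f' : P' ⟶ P) (p' : P' ⟶ T) (hp' : sm p') (e : f' ≫ p = p' ≫ f),
      -- Existence of `l` suffices; its uniqueness plays no role.
      (∀ {Q : C} (a : Q ⟶ P) (b : Q ⟶ T), a ≫ p = b ≫ f → ∃ l : Q ⟶ P', l ≫ f' = a ∧ l ≫ p' = b) ∧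
      (sm f → sm f') ∧
      ∀ hf : cl f, ∃ hf' : cl f',
        M.comp f' p (p' ≫ f) e (c f' hf') (s p hp) = M.comp p' f (p' ≫ f) rfl (s p' hp') (c f hf)

namespace MorphismLabels.GluingDatum

variable {C : Type u} [Category.{v} C] {M : MorphismLabels.{v, u, w} C}
  {cl sm : MorphismProperty C} (G : M.GluingDatum cl sm)

include G

/-- In the base change of `r` along `t'`, the pair `(t, 𝟙)` defines a section `l` of the projection
`p` to `T`. Writing `t = l ≫ q` and exchanging `q, r` for `p, t'` leaves the factor `l ≫ p = 𝟙`,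
whose label is neutral by `triangle`. -/
theorem c_eq_comp {T P P' : C} (t : T ⟶ P) (r : P ⟶ P') (t' : T ⟶ P') (e : t ≫ r = t')
    (ht : cl t) (hr : sm r) (ht' : cl t') :
    M.comp t r t' e (G.c t ht) (G.s r hr) = G.c t' ht' := by
  obtain ⟨Q, q, p, hp, w, hl, -, hx⟩ := G.exists_baseChange r t' hr
  obtain ⟨hq, hx⟩ := hx ht'
  obtain ⟨l, hl₁, hl₂⟩ := hl t (𝟙 T) (by rw [e, Category.id_comp])
  have hcl : cl l := G.cl_of_comp l q (hl₁ ▸ ht)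
  rw [← G.c_comp l q t hl₁ hcl hq ht,
    M.assoc l q r t (p ≫ t') t' hl₁ w (by rw [← Category.assoc, hl₂, Category.id_comp]) e, hx,
    ← M.assoc l p t' (𝟙 T) (p ≫ t') t' hl₂ rfl
      (by rw [← Category.assoc, hl₂, Category.id_comp]) (Category.id_comp t'),
    G.triangle l p (𝟙 T) hl₂ hcl hp (G.sm_id T), G.s_id_left]

/-- The label of `t ≫ p`, for `t` in `cl` and `p` in `sm`, does not depend on the factorization. -/
theorem comp_eq_comp {T P P' X : C} (t : T ⟶ P) (p : P ⟶ X) (t' : T ⟶ P') (p' : P' ⟶ X)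
    (f : T ⟶ X) (e : t ≫ p = f) (e' : t' ≫ p' = f) (ht : cl t) (hp : sm p) (ht' : cl t')
    (hp' : sm p') :
    M.comp t p f e (G.c t ht) (G.s p hp) = M.comp t' p' f e' (G.c t' ht') (G.s p' hp') := by
  -- A factorization may be replaced by any other one that maps to it by a smooth `r`.
  have dominated {P : C} (t : T ⟶ P) (p : P ⟶ X) (e : t ≫ p = f) (ht : cl t) (hp : sm p) {Q : C}
      (a : T ⟶ Q) (r : Q ⟶ P) (q : Q ⟶ X) (h₁ : a ≫ r = t) (h₂ : r ≫ p = q)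
      (e'' : a ≫ q = f) (ha : cl a) (hr : sm r) (hq : sm q) :
      M.comp t p f e (G.c t ht) (G.s p hp) = M.comp a q f e'' (G.c a ha) (G.s q hq) := by
    rw [← G.c_eq_comp a r t h₁ ha hr ht, M.assoc a r p t q f h₁ h₂ e'' e, G.s_comp r p q h₂ hr hp hq]
  -- The fibered product of `P` and `P'` over `X` dominates both factorizations.
  obtain ⟨Q, r, r', hr', w, hl, hr, -⟩ := G.exists_baseChange p p' hp
  obtain ⟨a, ha, ha'⟩ := hl t t' (e.trans e'.symm)
  have hcl : cl a := G.cl_of_comp a r (ha ▸ ht)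
  have e'' : a ≫ r ≫ p = f := by rw [← Category.assoc, ha, e]
  rw [dominated t p e ht hp a r (r ≫ p) ha rfl e'' hcl (hr hp') (G.sm_comp _ _ (hr hp') hp),
    dominated t' p' e' ht' hp' a r' (r ≫ p) ha' w.symm e'' hcl hr' (G.sm_comp _ _ (hr hp') hp)]

/-- The pair `(a, p)` defines a closed `l` into the base change of `q` along `z`, with `l ≫ z' = a`
and `l ≫ q' = p`. Splitting `a` through `l`, exchanging, and applying `triangle` to `l ≫ q' = p`
reorders smooth-then-closed into closed-then-smooth. -/
theorem exists_comp_eq_comp {P X V : C} (p : P ⟶ X) (z : X ⟶ V) (hp : sm p) (hz : cl z) :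
    ∃ (Q : C) (a : P ⟶ Q) (q : Q ⟶ V) (ha : cl a) (hq : sm q) (e : a ≫ q = p ≫ z),
      M.comp p z (p ≫ z) rfl (G.s p hp) (G.c z hz) =
        M.comp a q (p ≫ z) e (G.c a ha) (G.s q hq) := by
  obtain ⟨Q, a, q, ha, hq, e⟩ := G.factor (p ≫ z)
  obtain ⟨Q', z', q', hq', w, hl, -, hx⟩ := G.exists_baseChange q z hq
  obtain ⟨hz', hx⟩ := hx hz
  obtain ⟨l, hl₁, hl₂⟩ := hl a p e
  have hcl : cl l := G.cl_of_comp l z' (hl₁ ▸ ha)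
  have e' : l ≫ q' ≫ z = p ≫ z := by rw [← Category.assoc, hl₂]
  refine ⟨Q, a, q, ha, hq, e, ?_⟩
  rw [← G.c_comp l z' a hl₁ hcl hz' ha, M.assoc l z' q a (q' ≫ z) (p ≫ z) hl₁ w e' e, hx,
    ← M.assoc l q' z p (q' ≫ z) (p ≫ z) hl₂ rfl e' rfl, G.triangle l q' p hl₂ hcl hq' hp]

/-- The labels extend to all morphisms. -/
theorem exists_extension :
    ∃ m : ∀ {T X : C} (f : T ⟶ X), M.Label f,
      (∀ {T X V : C} (f : T ⟶ X) (g : X ⟶ V) (k : T ⟶ V) (e : f ≫ g = k),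
        m k = M.comp f g k e (m f) (m g)) ∧
      (∀ {T X : C} (f : T ⟶ X) (hf : sm f), m f = G.s f hf) ∧
      ∀ {T X : C} (f : T ⟶ X) (hf : cl f), m f = G.c f hf := by
  choose P t p ht hp e using fun {T X : C} (f : T ⟶ X) => G.factor f
  let m {T X : C} (f : T ⟶ X) : M.Label f :=
    M.comp (t f) (p f) f (e f) (G.c (t f) (ht f)) (G.s (p f) (hp f))
  have hm {T X : C} (f : T ⟶ X) {P' : C} (t' : T ⟶ P') (p' : P' ⟶ X) (e' : t' ≫ p' = f)
      (ht' : cl t') (hp' : sm p') :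
      m f = M.comp t' p' f e' (G.c t' ht') (G.s p' hp') :=
    G.comp_eq_comp _ _ _ _ _ _ _ _ _ _ _
  refine ⟨m, ?_, ?_, ?_⟩
  · intro T X V f g k h
    change m k = M.comp f g k h (m f) (m g)
    -- Reordering the middle pair of `t f`, `p f`, `t g`, `p g` puts the two closed factors first
    -- and the two smooth ones last.
    obtain ⟨Q, a, q, ha, hq, e', hx⟩ := G.exists_comp_eq_comp (p f) (t g) (hp f) (ht g)
    have h₁ : (t f ≫ a) ≫ q ≫ p g = k := by
      rw [Category.assoc, ← Category.assoc a, e', Category.assoc, e g, ← Category.assoc, e f, h]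
    have h₂ : (p f ≫ t g) ≫ p g = p f ≫ g := by rw [Category.assoc, e g]
    have h₃ : t f ≫ p f ≫ g = k := by rw [← Category.assoc, e f, h]
    have h₄ : a ≫ q ≫ p g = p f ≫ g := by rw [← Category.assoc, e', h₂]
    rw [hm k (t f ≫ a) (q ≫ p g) h₁ (G.cl_comp _ _ (ht f) ha) (G.sm_comp _ _ hq (hp g))]
    dsimp only [m]
    rw [M.assoc (t f) (p f) g f (p f ≫ g) k (e f) rfl h₃ h,
      ← M.assoc (p f) (t g) (p g) (p f ≫ t g) g (p f ≫ g) rfl (e g) rfl h₂, hx,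
      M.assoc a q (p g) (p f ≫ t g) (q ≫ p g) (p f ≫ g) e' rfl h₄ h₂,
      G.s_comp q (p g) _ rfl hq (hp g) (G.sm_comp _ _ hq (hp g)),
      ← M.assoc (t f) a (q ≫ p g) (t f ≫ a) (p f ≫ g) k rfl h₄ h₃ h₁,
      G.c_comp (t f) a _ rfl (ht f) ha (G.cl_comp _ _ (ht f) ha)]
  · intro T X f hf
    change m f = _
    rw [hm f (𝟙 T) f (Category.id_comp f) (G.cl_id T) hf, G.c_id_left]
  · intro T X f hf
    change m f = _
    rw [hm f f (𝟙 X) (Category.comp_id f) hf (G.sm_id X), G.s_id_right]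

end MorphismLabels.GluingDatum

/-! ### Components of units and counits -/

namespace CategoryTheory.Adjunction

universe v₁ v₂ u₁ u₂

variable {C : Type u₁} [Category.{v₁} C] {D : Type u₂} [Category.{v₂} D] {F : C ⥤ D} {G : D ⥤ C}
  (a : F ⊣ G)

/-- The component of the unit, as a morphism out of `X` itself. -/
def unitApp (X : C) : X ⟶ G.obj (F.obj X) := a.unit.app X

/-- The component of the counit, as a morphism to `Y` itself. -/
def counitApp (Y : D) : F.obj (G.obj Y) ⟶ Y := a.counit.app Y

theorem unitApp_naturality {X X' : C} (φ : X ⟶ X') :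
    φ ≫ a.unitApp X' = a.unitApp X ≫ G.map (F.map φ) := a.unit.naturality φ

theorem counitApp_naturality {Y Y' : D} (φ : Y ⟶ Y') :
    F.map (G.map φ) ≫ a.counitApp Y' = a.counitApp Y ≫ φ := a.counit.naturality φ

@[simp]
theorem map_unitApp_counitApp (X : C) : F.map (a.unitApp X) ≫ a.counitApp (F.obj X) = 𝟙 _ :=
  a.left_triangle_components X

@[simp]
theorem unitApp_map_counitApp (Y : D) : a.unitApp (G.obj Y) ≫ G.map (a.counitApp Y) = 𝟙 _ :=
  a.right_triangle_components Y

/-- Morphisms to `G.obj Y` are equal if their transposes are. -/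
theorem eq_of_map_comp_counitApp {X : C} {Y : D} {f g : X ⟶ G.obj Y}
    (h : F.map f ≫ a.counitApp Y = F.map g ≫ a.counitApp Y) : f = g :=
  (a.homEquiv X Y).symm.injective (by simpa [Adjunction.homEquiv_counit, counitApp] using h)

end CategoryTheory.Adjunction

/-! ### Components of monoidality isomorphisms -/

section MonoidalityIso

variable {S : Type u} [Category.{v} S] [HasBinaryProducts S]
  {H : FiberedCategory.{v, u, w', w} S} [H.Triangulated]

namespace ExternalProduct

/-- The morphism `φ₁ ⊠ φ₂`, as an irreducible variant of `ExternalProduct.map`. -/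
noncomputable def tensor (B : ExternalProduct H) {X₁ X₂ : S} {A₁ A₁' : H.fib X₁} {A₂ A₂' : H.fib X₂}
    (φ₁ : A₁ ⟶ A₁') (φ₂ : A₂ ⟶ A₂') : B.obj A₁ A₂ ⟶ B.obj A₁' A₂' := B.map φ₁ φ₂

theorem tensor_eq_map (B : ExternalProduct H) {X₁ X₂ : S} {A₁ A₁' : H.fib X₁} {A₂ A₂' : H.fib X₂}
    (φ₁ : A₁ ⟶ A₁') (φ₂ : A₂ ⟶ A₂') : B.tensor φ₁ φ₂ = B.map φ₁ φ₂ := rfl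

/-- The shift arguments vary one factor at a time and need both orders of the two factors. -/
theorem tensor_eq_comp (B : ExternalProduct H) {X₁ X₂ : S} {A₁ A₁' : H.fib X₁} {A₂ A₂' : H.fib X₂}
    (φ₁ : A₁ ⟶ A₁') (φ₂ : A₂ ⟶ A₂') :
    B.tensor φ₁ φ₂ = ((B.box X₁ X₂).obj A₁).map φ₂ ≫ ((B.box X₁ X₂).map φ₁).app A₂' :=
  (((B.box X₁ X₂).map φ₁).naturality φ₂).symm

theorem tensor_comp (B : ExternalProduct H) {X₁ X₂ : S} {A₁ A₁' A₁'' : H.fib X₁}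
    {A₂ A₂' A₂'' : H.fib X₂} (φ₁ : A₁ ⟶ A₁') (ψ₁ : A₁' ⟶ A₁'') (φ₂ : A₂ ⟶ A₂') (ψ₂ : A₂' ⟶ A₂'') :
    B.tensor (φ₁ ≫ ψ₁) (φ₂ ≫ ψ₂) = B.tensor φ₁ φ₂ ≫ B.tensor ψ₁ ψ₂ := by
  simp [ExternalProduct.map, tensor]

@[simp]
theorem tensor_id (B : ExternalProduct H) {X₁ X₂ : S} (A₁ : H.fib X₁) (A₂ : H.fib X₂) :
    B.tensor (𝟙 A₁) (𝟙 A₂) = 𝟙 (B.obj A₁ A₂) := by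
  simp [ExternalProduct.map, tensor]

theorem tensor_id_right (B : ExternalProduct H) {X₁ X₂ : S} {A₁ A₁' : H.fib X₁}
    (φ₁ : A₁ ⟶ A₁') (A₂ : H.fib X₂) :
    B.tensor φ₁ (𝟙 A₂) = ((B.box X₁ X₂).map φ₁).app A₂ := by
  simp [ExternalProduct.map, tensor]

theorem tensor_id_left (B : ExternalProduct H) {X₁ X₂ : S} (A₁ : H.fib X₁) {A₂ A₂' : H.fib X₂}
    (φ₂ : A₂ ⟶ A₂') :
    B.tensor (𝟙 A₁) φ₂ = ((B.box X₁ X₂).obj A₁).map φ₂ := by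
  simp [ExternalProduct.map, tensor]

/-- The isomorphism `φ₁ ⊠ φ₂`. -/
@[simps]
noncomputable def tensorIso (B : ExternalProduct H) {X₁ X₂ : S} {A₁ A₁' : H.fib X₁}
    {A₂ A₂' : H.fib X₂} (φ₁ : A₁ ≅ A₁') (φ₂ : A₂ ≅ A₂') : B.obj A₁ A₂ ≅ B.obj A₁' A₂' where
  hom := B.tensor φ₁.hom φ₂.hom
  inv := B.tensor φ₁.inv φ₂.inv
  hom_inv_id := by simp [← tensor_comp]
  inv_hom_id := by simp [← tensor_comp]

instance isIso_tensor (B : ExternalProduct H) {X₁ X₂ : S} {A₁ A₁' : H.fib X₁}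
    {A₂ A₂' : H.fib X₂} (φ₁ : A₁ ⟶ A₁') (φ₂ : A₂ ⟶ A₂') [IsIso φ₁] [IsIso φ₂] :
    IsIso (B.tensor φ₁ φ₂) :=
  (B.tensorIso (asIso φ₁) (asIso φ₂)).isIso_hom

namespace MonoidalityIso

variable {B : ExternalProduct H} {X₁ X₂ Y₁ Y₂ : S}
  {F₁ : H.fib X₁ ⥤ H.fib Y₁} {F₂ : H.fib X₂ ⥤ H.fib Y₂} {F : H.fib (X₁ ⨯ X₂) ⥤ H.fib (Y₁ ⨯ Y₂)}

/-- The components of a monoidality isomorphism. -/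
@[simps]
noncomputable def component (m : B.MonoidalityIso F₁ F₂ F) (A₁ : H.fib X₁) (A₂ : H.fib X₂) :
    B.obj (F₁.obj A₁) (F₂.obj A₂) ≅ F.obj (B.obj A₁ A₂) where
  hom := (m.hom.app A₁).app A₂
  inv := (m.inv.app A₁).app A₂
  hom_inv_id := by rw [← NatTrans.comp_app, ← NatTrans.comp_app, m.hom_inv_id]; rfl
  inv_hom_id := by rw [← NatTrans.comp_app, ← NatTrans.comp_app, m.inv_hom_id]; rfl

attribute [-simp] component_hom component_inv

theorem component_naturality (m : B.MonoidalityIso F₁ F₂ F) {A₁ A₁' : H.fib X₁} {A₂ A₂' : H.fib X₂}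
    (φ₁ : A₁ ⟶ A₁') (φ₂ : A₂ ⟶ A₂') :
    B.tensor (F₁.map φ₁) (F₂.map φ₂) ≫ (m.component A₁' A₂').hom =
      (m.component A₁ A₂).hom ≫ F.map (B.tensor φ₁ φ₂) := by
  have h₁ := NatTrans.congr_app (m.hom.naturality φ₁) A₂
  have h₂ := (m.hom.app A₁').naturality φ₂
  dsimp [component, tensor] at h₁ h₂ ⊢
  simp [h₂, reassoc_of% h₁]

theorem component_inv_naturality (m : B.MonoidalityIso F₁ F₂ F) {A₁ A₁' : H.fib X₁}
    {A₂ A₂' : H.fib X₂} (φ₁ : A₁ ⟶ A₁') (φ₂ : A₂ ⟶ A₂') :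
    F.map (B.tensor φ₁ φ₂) ≫ (m.component A₁' A₂').inv =
      (m.component A₁ A₂).inv ≫ B.tensor (F₁.map φ₁) (F₂.map φ₂) := by
  rw [Iso.comp_inv_eq, Category.assoc, component_naturality, Iso.inv_hom_id_assoc]

theorem ext_component {m m' : B.MonoidalityIso F₁ F₂ F}
    (h : ∀ A₁ A₂, (m.component A₁ A₂).hom = (m'.component A₁ A₂).hom) : m = m' := by
  apply Iso.ext
  ext A₁ A₂
  exact h A₁ A₂

theorem ext_component_inv {m m' : B.MonoidalityIso F₁ F₂ F}
    (h : ∀ A₁ A₂, (m.component A₁ A₂).inv = (m'.component A₁ A₂).inv) : m = m' :=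
  ext_component fun A₁ A₂ =>
    congrArg Iso.hom (Iso.ext_inv (h A₁ A₂))

/-- The natural isomorphism with given components. -/
noncomputable def ofComponents
    (i : ∀ (A₁ : H.fib X₁) (A₂ : H.fib X₂),
      B.obj (F₁.obj A₁) (F₂.obj A₂) ≅ F.obj (B.obj A₁ A₂))
    (nat : ∀ {A₁ A₁' : H.fib X₁} {A₂ A₂' : H.fib X₂} (φ₁ : A₁ ⟶ A₁') (φ₂ : A₂ ⟶ A₂'),
      B.tensor (F₁.map φ₁) (F₂.map φ₂) ≫ (i A₁' A₂').hom =
        (i A₁ A₂).hom ≫ F.map (B.tensor φ₁ φ₂)) :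
    B.MonoidalityIso F₁ F₂ F :=
  NatIso.ofComponents
    (fun A₁ => NatIso.ofComponents (F := F₂ ⋙ (B.box Y₁ Y₂).obj (F₁.obj A₁))
      (G := (B.box X₁ X₂).obj A₁ ⋙ F) (fun A₂ => i A₁ A₂) (fun φ₂ => by
        simpa [tensor, ExternalProduct.map] using nat (𝟙 A₁) φ₂))
    (fun {A₁ A₁'} φ₁ => by
      ext A₂
      simpa [tensor, ExternalProduct.map] using nat φ₁ (𝟙 A₂))

@[simp]
theorem ofComponents_component (i nat) (A₁ : H.fib X₁) (A₂ : H.fib X₂) :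
    (ofComponents (B := B) (F₁ := F₁) (F₂ := F₂) (F := F) i nat).component A₁ A₂ = i A₁ A₂ := rfl

end MonoidalityIso

end ExternalProduct

end MonoidalityIso

/-! ### Connection isomorphisms of inverse images -/

namespace FiberedCategory

variable {S : Type u} [Category.{v} S] (H : FiberedCategory.{v, u, w', w} S)

/-- The components of the connection isomorphisms. -/
noncomputable def connApp {T X V : S} (f : T ⟶ X) (g : X ⟶ V) (k : T ⟶ V) (e : f ≫ g = k) (A : H.fib V) :
    (H.pull k).obj A ≅ (H.pull f).obj ((H.pull g).obj A) := (H.conn f g k e).app A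

theorem connApp_hom_naturality {T X V : S} (f : T ⟶ X) (g : X ⟶ V) (k : T ⟶ V) (e : f ≫ g = k)
    {A A' : H.fib V} (φ : A ⟶ A') :
    (H.pull k).map φ ≫ (H.connApp f g k e A').hom =
      (H.connApp f g k e A).hom ≫ (H.pull f).map ((H.pull g).map φ) :=
  (H.conn f g k e).hom.naturality φ

theorem connApp_inv_naturality {T X V : S} (f : T ⟶ X) (g : X ⟶ V) (k : T ⟶ V) (e : f ≫ g = k)
    {A A' : H.fib V} (φ : A ⟶ A') :
    (H.pull f).map ((H.pull g).map φ) ≫ (H.connApp f g k e A').inv =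
      (H.connApp f g k e A).inv ≫ (H.pull k).map φ :=
  (H.conn f g k e).inv.naturality φ

theorem connApp_assoc {T X V W : S} (f : T ⟶ X) (g : X ⟶ V) (h : V ⟶ W) (fg : T ⟶ V)
    (gh : X ⟶ W) (k : T ⟶ W) (e₁ : f ≫ g = fg) (e₂ : g ≫ h = gh) (e₃ : f ≫ gh = k)
    (e₄ : fg ≫ h = k) (A : H.fib W) :
    (H.connApp f gh k e₃ A).hom ≫ (H.pull f).map (H.connApp g h gh e₂ A).hom =
      (H.connApp fg h k e₄ A).hom ≫ (H.connApp f g fg e₁ ((H.pull h).obj A)).hom :=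
  H.conn_assoc f g h fg gh k e₁ e₂ e₃ e₄ A

theorem connApp_assoc_inv {T X V W : S} (f : T ⟶ X) (g : X ⟶ V) (h : V ⟶ W) (fg : T ⟶ V)
    (gh : X ⟶ W) (k : T ⟶ W) (e₁ : f ≫ g = fg) (e₂ : g ≫ h = gh) (e₃ : f ≫ gh = k)
    (e₄ : fg ≫ h = k) (A : H.fib W) :
    (H.pull f).map (H.connApp g h gh e₂ A).inv ≫ (H.connApp f gh k e₃ A).inv =
      (H.connApp f g fg e₁ ((H.pull h).obj A)).inv ≫ (H.connApp fg h k e₄ A).inv := by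
  have := H.connApp_assoc f g h fg gh k e₁ e₂ e₃ e₄ A
  have h' := congrArg Iso.inv (Iso.ext (α := _ ≪≫ (H.pull f).mapIso _) (β := _ ≪≫ _) this)
  simpa using h'

/-- The name of the composite is immaterial. This is needed because a product of composites and the
composite of the products are different expressions for one morphism. -/
theorem connApp_inv_hom_eq {T X Y V : S} (f : T ⟶ X) (g : X ⟶ V) (f' : T ⟶ Y) (g' : Y ⟶ V)
    (k k' : T ⟶ V) (e₁ : f ≫ g = k) (e₂ : f' ≫ g' = k) (e₁' : f ≫ g = k') (e₂' : f' ≫ g' = k')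
    (A : H.fib V) :
    (H.connApp f g k e₁ A).inv ≫ (H.connApp f' g' k e₂ A).hom =
      (H.connApp f g k' e₁' A).inv ≫ (H.connApp f' g' k' e₂' A).hom := by
  obtain rfl : k = k' := e₁.symm.trans e₁'
  rfl

theorem pull_faithful_of_eq_id {X : S} (f : X ⟶ X) (e : f = 𝟙 X) : (H.pull f).Faithful := by
  subst e
  exact Functor.Faithful.of_iso (H.pullId X).symm

end FiberedCategory

/-! ### Composition of monoidality isomorphisms -/

namespace ExternalProduct.MonoidalityIso

variable {S : Type u} [Category.{v} S] [HasBinaryProducts S]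
  {H : FiberedCategory.{v, u, w', w} S} [H.Triangulated] {B : ExternalProduct H}

section comp

theorem prodMap_comp {T₁ X₁ V₁ T₂ X₂ V₂ : S} {f₁ : T₁ ⟶ X₁} {g₁ : X₁ ⟶ V₁} {k₁ : T₁ ⟶ V₁}
    {f₂ : T₂ ⟶ X₂} {g₂ : X₂ ⟶ V₂} {k₂ : T₂ ⟶ V₂} (e₁ : f₁ ≫ g₁ = k₁) (e₂ : f₂ ≫ g₂ = k₂) :
    prod.map f₁ f₂ ≫ prod.map g₁ g₂ = prod.map k₁ k₂ := by
  rw [prod.map_map, e₁, e₂]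

variable {T₁ X₁ V₁ T₂ X₂ V₂ : S} (f₁ : T₁ ⟶ X₁) (g₁ : X₁ ⟶ V₁) (k₁ : T₁ ⟶ V₁)
    (f₂ : T₂ ⟶ X₂) (g₂ : X₂ ⟶ V₂) (k₂ : T₂ ⟶ V₂) (e₁ : f₁ ≫ g₁ = k₁) (e₂ : f₂ ≫ g₂ = k₂)
    (μ : B.MonoidalityIso (H.pull f₁) (H.pull f₂) (H.pull (prod.map f₁ f₂)))
    (ν : B.MonoidalityIso (H.pull g₁) (H.pull g₂) (H.pull (prod.map g₁ g₂)))

/-- The composite monoidality isomorphism for `(f₁ ≫ g₁, f₂ ≫ g₂)`. -/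
noncomputable def comp :
    B.MonoidalityIso (H.pull k₁) (H.pull k₂) (H.pull (prod.map k₁ k₂)) :=
  ofComponents (fun A₁ A₂ =>
    B.tensorIso (H.connApp f₁ g₁ k₁ e₁ A₁) (H.connApp f₂ g₂ k₂ e₂ A₂) ≪≫
      μ.component ((H.pull g₁).obj A₁) ((H.pull g₂).obj A₂) ≪≫
      (H.pull (prod.map f₁ f₂)).mapIso (ν.component A₁ A₂) ≪≫
      (H.connApp (prod.map f₁ f₂) (prod.map g₁ g₂) (prod.map k₁ k₂)
          (prodMap_comp e₁ e₂) (B.obj A₁ A₂)).symm)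
    (fun {A₁ A₁' A₂ A₂'} φ₁ φ₂ => by
      simp only [Iso.trans_hom, Iso.symm_hom, Functor.mapIso_hom, tensorIso_hom, Category.assoc]
      rw [← H.connApp_inv_naturality, ← Functor.map_comp_assoc, ← component_naturality,
        Functor.map_comp_assoc, ← reassoc_of% μ.component_naturality, ← reassoc_of% B.tensor_comp,
        ← reassoc_of% B.tensor_comp, H.connApp_hom_naturality, H.connApp_hom_naturality])

theorem comp_component_hom (A₁ : H.fib V₁) (A₂ : H.fib V₂) :
    ((comp f₁ g₁ k₁ f₂ g₂ k₂ e₁ e₂ μ ν).component A₁ A₂).hom =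
      B.tensor (H.connApp f₁ g₁ k₁ e₁ A₁).hom (H.connApp f₂ g₂ k₂ e₂ A₂).hom ≫
      (μ.component ((H.pull g₁).obj A₁) ((H.pull g₂).obj A₂)).hom ≫
      (H.pull (prod.map f₁ f₂)).map (ν.component A₁ A₂).hom ≫
      (H.connApp (prod.map f₁ f₂) (prod.map g₁ g₂) (prod.map k₁ k₂)
          (prodMap_comp e₁ e₂) (B.obj A₁ A₂)).inv := by
  simp [comp]

theorem comp_component_inv (A₁ : H.fib V₁) (A₂ : H.fib V₂) :
    ((comp f₁ g₁ k₁ f₂ g₂ k₂ e₁ e₂ μ ν).component A₁ A₂).inv =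
      (H.connApp (prod.map f₁ f₂) (prod.map g₁ g₂) (prod.map k₁ k₂)
          (prodMap_comp e₁ e₂) (B.obj A₁ A₂)).hom ≫
      (H.pull (prod.map f₁ f₂)).map (ν.component A₁ A₂).inv ≫
      (μ.component ((H.pull g₁).obj A₁) ((H.pull g₂).obj A₂)).inv ≫
      B.tensor (H.connApp f₁ g₁ k₁ e₁ A₁).inv (H.connApp f₂ g₂ k₂ e₂ A₂).inv := by
  simp [comp]

end comp

/-- Naturality of `μ` reduces this to coherence of the connection isomorphisms, in the two factors
and on the product. -/
theorem comp_assoc {T₁ X₁ V₁ W₁ T₂ X₂ V₂ W₂ : S}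
    (f₁ : T₁ ⟶ X₁) (g₁ : X₁ ⟶ V₁) (h₁ : V₁ ⟶ W₁) (fg₁ : T₁ ⟶ V₁) (gh₁ : X₁ ⟶ W₁) (k₁ : T₁ ⟶ W₁)
    (f₂ : T₂ ⟶ X₂) (g₂ : X₂ ⟶ V₂) (h₂ : V₂ ⟶ W₂) (fg₂ : T₂ ⟶ V₂) (gh₂ : X₂ ⟶ W₂) (k₂ : T₂ ⟶ W₂)
    (d₁ : f₁ ≫ g₁ = fg₁) (d₂ : g₁ ≫ h₁ = gh₁) (d₃ : f₁ ≫ gh₁ = k₁) (d₄ : fg₁ ≫ h₁ = k₁)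
    (e₁ : f₂ ≫ g₂ = fg₂) (e₂ : g₂ ≫ h₂ = gh₂) (e₃ : f₂ ≫ gh₂ = k₂) (e₄ : fg₂ ≫ h₂ = k₂)
    (μ : B.MonoidalityIso (H.pull f₁) (H.pull f₂) (H.pull (prod.map f₁ f₂)))
    (ν : B.MonoidalityIso (H.pull g₁) (H.pull g₂) (H.pull (prod.map g₁ g₂)))
    (ρ : B.MonoidalityIso (H.pull h₁) (H.pull h₂) (H.pull (prod.map h₁ h₂))) :
    comp fg₁ h₁ k₁ fg₂ h₂ k₂ d₄ e₄ (comp f₁ g₁ fg₁ f₂ g₂ fg₂ d₁ e₁ μ ν) ρ =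
      comp f₁ gh₁ k₁ f₂ gh₂ k₂ d₃ e₃ μ (comp g₁ h₁ gh₁ g₂ h₂ gh₂ d₂ e₂ ν ρ) := by
  apply ext_component
  intro A₁ A₂
  simp only [comp_component_hom, Category.assoc, Functor.map_comp]
  rw [← reassoc_of% B.tensor_comp, ← H.connApp_assoc _ _ _ _ gh₁ _ d₁ d₂ d₃ d₄,
    ← H.connApp_assoc _ _ _ _ gh₂ _ e₁ e₂ e₃ e₄, B.tensor_comp, Category.assoc,
    reassoc_of% μ.component_naturality,
    ← reassoc_of% H.connApp_inv_naturality (prod.map f₁ f₂) (prod.map g₁ g₂) (prod.map fg₁ fg₂),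
    H.connApp_assoc_inv (prod.map f₁ f₂) (prod.map g₁ g₂) (prod.map h₁ h₂) (prod.map fg₁ fg₂)
      (prod.map gh₁ gh₂) (prod.map k₁ k₂) (prodMap_comp d₁ e₁)]

section unit

variable {T₁ X₁ T₂ X₂ : S} (f₁ : T₁ ⟶ X₁) (f₂ : T₂ ⟶ X₂)
    (ν : B.MonoidalityIso (H.pull f₁) (H.pull f₂) (H.pull (prod.map f₁ f₂)))

/-- Up to isomorphisms, composing with `μ` applies `(𝟙 × 𝟙)^*` to the components of `ν`, and this
functor is faithful. -/
theorem comp_left_injective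
    (μ : B.MonoidalityIso (H.pull (𝟙 T₁)) (H.pull (𝟙 T₂)) (H.pull (prod.map (𝟙 T₁) (𝟙 T₂)))) :
    Function.Injective (comp (𝟙 T₁) f₁ f₁ (𝟙 T₂) f₂ f₂ (Category.id_comp f₁) (Category.id_comp f₂) μ)
    := by
  intro ν ν' h
  apply ext_component
  intro A₁ A₂
  have h := congrArg (fun m => (component m A₁ A₂).hom) h
  simp only [comp_component_hom, cancel_epi, cancel_mono] at h
  have := H.pull_faithful_of_eq_id (prod.map (𝟙 T₁) (𝟙 T₂)) prod.map_id_id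
  exact (H.pull _).map_injective h

/-- The composite sees `ν` only at the objects `𝟙^* A₁`, `𝟙^* A₂`; naturality along `pullId`
transports the equality to `A₁`, `A₂`. -/
theorem comp_right_injective
    (μ : B.MonoidalityIso (H.pull (𝟙 X₁)) (H.pull (𝟙 X₂)) (H.pull (prod.map (𝟙 X₁) (𝟙 X₂)))) :
    Function.Injective (fun ν =>
      comp f₁ (𝟙 X₁) f₁ f₂ (𝟙 X₂) f₂ (Category.comp_id f₁) (Category.comp_id f₂) ν μ) := by
  intro ν ν' h
  apply ext_component
  intro A₁ A₂
  have h := congrArg (fun m => (component m A₁ A₂).hom) h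
  simp only [comp_component_hom, cancel_epi] at h
  simp only [← Category.assoc, cancel_mono] at h
  have n := ν.component_naturality ((H.pullId X₁).hom.app A₁) ((H.pullId X₂).hom.app A₂)
  have n' := ν'.component_naturality ((H.pullId X₁).hom.app A₁) ((H.pullId X₂).hom.app A₂)
  rw [h, ← n'] at n
  exact (cancel_epi _).1 n

variable
    (ε : B.MonoidalityIso (H.pull (𝟙 T₁)) (H.pull (𝟙 T₂)) (H.pull (prod.map (𝟙 T₁) (𝟙 T₂))))
    (hε : comp (𝟙 T₁) (𝟙 T₁) (𝟙 T₁) (𝟙 T₂) (𝟙 T₂) (𝟙 T₂) (Category.id_comp _) (Category.id_comp _)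
      ε ε = ε)
include hε

/-- From `ε(εν) = (εε)ν = εν` one cancels `ε`. External tensor structures have no unit axiom; this
lemma supplies it, since `m` at identities is idempotent by `m_comp`. -/
theorem idem_comp :
    comp (𝟙 T₁) f₁ f₁ (𝟙 T₂) f₂ f₂ (Category.id_comp f₁) (Category.id_comp f₂) ε ν = ν := by
  apply comp_left_injective f₁ f₂ ε
  rw [← comp_assoc _ _ _ (𝟙 T₁) f₁ _ _ _ _ (𝟙 T₂) f₂ _ (Category.id_comp _) _ _ _
    (Category.id_comp _), hε]

end unit

theorem comp_idem {T₁ X₁ T₂ X₂ : S} (f₁ : T₁ ⟶ X₁) (f₂ : T₂ ⟶ X₂)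
    (ν : B.MonoidalityIso (H.pull f₁) (H.pull f₂) (H.pull (prod.map f₁ f₂)))
    (ε : B.MonoidalityIso (H.pull (𝟙 X₁)) (H.pull (𝟙 X₂)) (H.pull (prod.map (𝟙 X₁) (𝟙 X₂))))
    (hε : comp (𝟙 X₁) (𝟙 X₁) (𝟙 X₁) (𝟙 X₂) (𝟙 X₂) (𝟙 X₂) (Category.id_comp _)
      (Category.id_comp _) ε ε = ε) :
    comp f₁ (𝟙 X₁) f₁ f₂ (𝟙 X₂) f₂ (Category.comp_id f₁) (Category.comp_id f₂) ν ε = ν := by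
  apply comp_right_injective f₁ f₂ ε
  dsimp only
  rw [comp_assoc _ _ _ f₁ (𝟙 X₁) _ _ _ _ f₂ (𝟙 X₂) _ _ (Category.id_comp _) _ _ _
    (Category.id_comp _), hε]

end ExternalProduct.MonoidalityIso

/-! ### Compatibility with shifts -/

namespace ExternalProduct.MonoidalityIso

variable {S : Type u} [Category.{v} S] [HasBinaryProducts S]
  {H : FiberedCategory.{v, u, w', w} S} [H.Triangulated] {B : ExternalProduct H}

/-- With one variable fixed, the composite is a pasting of `μ` and `ν` with the connection
isomorphisms of the moving variable and of the product. The connection isomorphism of the fixed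
variable only changes the fixed argument of `⊠`, which respects shifts. -/
theorem Triangulated.comp {T₁ X₁ V₁ T₂ X₂ V₂ : S} {f₁ : T₁ ⟶ X₁} {g₁ : X₁ ⟶ V₁} (k₁ : T₁ ⟶ V₁)
    {f₂ : T₂ ⟶ X₂} {g₂ : X₂ ⟶ V₂} (k₂ : T₂ ⟶ V₂) (e₁ : f₁ ≫ g₁ = k₁) (e₂ : f₂ ≫ g₂ = k₂)
    {μ : B.MonoidalityIso (H.pull f₁) (H.pull f₂) (H.pull (prod.map f₁ f₂))}
    {ν : B.MonoidalityIso (H.pull g₁) (H.pull g₂) (H.pull (prod.map g₁ g₂))}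
    (hμ : μ.Triangulated) (hν : ν.Triangulated) :
    (comp f₁ g₁ k₁ f₂ g₂ k₂ e₁ e₂ μ ν).Triangulated where
  commShift_right A₁ := by
    have h₁ := hμ.commShift_right ((H.pull g₁).obj A₁)
    have h₂ := hν.commShift_right A₁
    refine NatTrans.CommShift.verticalComposition (H.conn f₂ g₂ k₂ e₂).hom
      (H.conn (prod.map f₁ f₂) (prod.map g₁ g₂) (prod.map k₁ k₂) (prodMap_comp e₁ e₂)).inv
      (L₁ := (B.box V₁ V₂).obj A₁) (L₂ := (B.box X₁ X₂).obj ((H.pull g₁).obj A₁))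
      (L₃ := (B.box T₁ T₂).obj ((H.pull k₁).obj A₁)) (ν.hom.app A₁)
      (Functor.whiskerLeft (H.pull f₂) ((B.box T₁ T₂).map ((H.conn f₁ g₁ k₁ e₁).hom.app A₁)) ≫
        (by exact μ.hom.app ((H.pull g₁).obj A₁) :
          H.pull f₂ ⋙ (B.box T₁ T₂).obj ((H.pull f₁).obj ((H.pull g₁).obj A₁)) ⟶ _)) _ ℤ ?_
    ext A₂
    refine (comp_component_hom f₁ g₁ k₁ f₂ g₂ k₂ e₁ e₂ μ ν A₁ A₂).trans ?_
    simp [component, FiberedCategory.connApp, tensor_eq_comp]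
  commShift_left A₂ := by
    have h₁ := hμ.commShift_left ((H.pull g₂).obj A₂)
    have h₂ := hν.commShift_left A₂
    refine NatTrans.CommShift.verticalComposition (H.conn f₁ g₁ k₁ e₁).hom
      (H.conn (prod.map f₁ f₂) (prod.map g₁ g₂) (prod.map k₁ k₂) (prodMap_comp e₁ e₂)).inv
      (L₁ := (B.box V₁ V₂).flip.obj A₂) (L₂ := (B.box X₁ X₂).flip.obj ((H.pull g₂).obj A₂))
      (L₃ := (B.box T₁ T₂).flip.obj ((H.pull k₂).obj A₂)) (ν.hom.flipApp A₂)
      (Functor.whiskerLeft (H.pull f₁) ((B.box T₁ T₂).flip.map ((H.conn f₂ g₂ k₂ e₂).hom.app A₂)) ≫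
        (by exact μ.hom.flipApp ((H.pull g₂).obj A₂) :
          H.pull f₁ ⋙ (B.box T₁ T₂).flip.obj ((H.pull f₂).obj ((H.pull g₂).obj A₂)) ⟶ _)) _ ℤ ?_
    ext A₁
    refine (comp_component_hom f₁ g₁ k₁ f₂ g₂ k₂ e₁ e₂ μ ν A₁ A₂).trans ?_
    simp [component, FiberedCategory.connApp, tensor_eq_map]

end ExternalProduct.MonoidalityIso

namespace CategoryTheory.Adjunction

/-- A mate is a whiskered composite of the unit, the given transformation and the counit, all of
which respect shifts. -/
theorem commShift_rightMate {C D E K : Type*} [Category C] [Category D] [Category E] [Category K]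
    [HasShift C ℤ] [HasShift D ℤ] [HasShift E ℤ] [HasShift K ℤ]
    {G : C ⥤ E} {H : D ⥤ K} {L₁ : C ⥤ D} {R₁ : D ⥤ C} {L₂ : E ⥤ K} {R₂ : K ⥤ E}
    (adj₁ : L₁ ⊣ R₁) (adj₂ : L₂ ⊣ R₂) [G.CommShift ℤ] [H.CommShift ℤ] [L₁.CommShift ℤ]
    [R₁.CommShift ℤ] [L₂.CommShift ℤ] [R₂.CommShift ℤ] [adj₁.CommShift ℤ] [adj₂.CommShift ℤ]
    (α : G ⋙ L₂ ⟶ L₁ ⋙ H) [NatTrans.CommShift α ℤ] (β : R₁ ⋙ G ⟶ H ⋙ R₂)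
    (hβ : ∀ d, β.app d = adj₂.unit.app _ ≫ R₂.map (α.app (R₁.obj d)) ≫
      R₂.map (H.map (adj₁.counit.app d))) : NatTrans.CommShift β ℤ := by
  have : β = R₁.whiskerLeft (G.rightUnitor.inv ≫ G.whiskerLeft adj₂.unit ≫
      (G.associator L₂ R₂).inv ≫ Functor.whiskerRight α R₂ ≫ (L₁.associator H R₂).hom) ≫
      (R₁.associator L₁ (H ⋙ R₂)).inv ≫ Functor.whiskerRight adj₁.counit (H ⋙ R₂) ≫
      (H ⋙ R₂).leftUnitor.hom := by
    ext d
    simp [hβ]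
  rw [this]
  infer_instance

theorem commShift_leftMate {C D E K : Type*} [Category C] [Category D] [Category E] [Category K]
    [HasShift C ℤ] [HasShift D ℤ] [HasShift E ℤ] [HasShift K ℤ]
    {G : C ⥤ E} {H : D ⥤ K} {L₁ : C ⥤ D} {R₁ : D ⥤ C} {L₂ : E ⥤ K} {R₂ : K ⥤ E}
    (adj₁ : L₁ ⊣ R₁) (adj₂ : L₂ ⊣ R₂) [G.CommShift ℤ] [H.CommShift ℤ] [L₁.CommShift ℤ]
    [R₁.CommShift ℤ] [L₂.CommShift ℤ] [R₂.CommShift ℤ] [adj₁.CommShift ℤ] [adj₂.CommShift ℤ]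
    (α : G ⋙ L₂ ⟶ L₁ ⋙ H) (β : R₁ ⋙ G ⟶ H ⋙ R₂) [NatTrans.CommShift β ℤ]
    (hα : ∀ d, α.app d = L₂.map (G.map (adj₁.unit.app d)) ≫ L₂.map (β.app (L₁.obj d)) ≫
      adj₂.counit.app _) : NatTrans.CommShift α ℤ := by
  have : α = (G ⋙ L₂).leftUnitor.inv ≫ Functor.whiskerRight adj₁.unit (G ⋙ L₂) ≫
      (L₁.associator R₁ (G ⋙ L₂)).hom ≫ L₁.whiskerLeft ((R₁.associator G L₂).inv ≫
        Functor.whiskerRight β L₂ ≫ (H.associator R₂ L₂).hom ≫ H.whiskerLeft adj₂.counit ≫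
        H.rightUnitor.hom) := by
    ext d
    simp [hα]
  rw [this]
  infer_instance

end CategoryTheory.Adjunction

theorem CategoryTheory.NatTrans.CommShift.of_inverse {C D : Type*} [Category C] [Category D]
    [HasShift C ℤ] [HasShift D ℤ] {F G : C ⥤ D} [F.CommShift ℤ] [G.CommShift ℤ] (α : F ⟶ G)
    (β : G ⟶ F) (h₁ : α ≫ β = 𝟙 F) (h₂ : β ≫ α = 𝟙 G) [NatTrans.CommShift α ℤ] :
    NatTrans.CommShift β ℤ :=
  NatTrans.CommShift.of_iso_inv ⟨α, β, h₁, h₂⟩ ℤ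

/-! ### Mates of monoidality isomorphisms -/

namespace ExternalProduct.MonoidalityIso

variable {S : Type u} [Category.{v} S] [HasBinaryProducts S]
  {H : FiberedCategory.{v, u, w', w} S} [H.Triangulated] {B : ExternalProduct H}

section mates

variable {X₁ X₂ Z₁ Z₂ : S}
  {F₁ : H.fib X₁ ⥤ H.fib Z₁} {F₂ : H.fib X₂ ⥤ H.fib Z₂} {F : H.fib (X₁ ⨯ X₂) ⥤ H.fib (Z₁ ⨯ Z₂)}
  {G₁ : H.fib Z₁ ⥤ H.fib X₁} {G₂ : H.fib Z₂ ⥤ H.fib X₂} {G : H.fib (Z₁ ⨯ Z₂) ⥤ H.fib (X₁ ⨯ X₂)}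
  (a₁ : F₁ ⊣ G₁) (a₂ : F₂ ⊣ G₂) (a : F ⊣ G)

/-- The monoidality isomorphisms `m` of right adjoints is the mate of the inverse of the
monoidality isomorphism `c` of left adjoints. -/
def IsMate (c : B.MonoidalityIso F₁ F₂ F) (m : B.MonoidalityIso G₁ G₂ G) : Prop :=
  ∀ (A₁ : H.fib Z₁) (A₂ : H.fib Z₂), F.map (m.component A₁ A₂).hom ≫ a.counitApp (B.obj A₁ A₂) =
    (c.component (G₁.obj A₁) (G₂.obj A₂)).inv ≫ B.tensor (a₁.counitApp A₁) (a₂.counitApp A₂)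

/-- The mate `G₁ A₁ ⊠ G₂ A₂ ⟶ G (A₁ ⊠ A₂)` of the inverse of a monoidality isomorphism. -/
noncomputable def rightMateApp (c : B.MonoidalityIso F₁ F₂ F) (A₁ : H.fib Z₁) (A₂ : H.fib Z₂) :
    B.obj (G₁.obj A₁) (G₂.obj A₂) ⟶ G.obj (B.obj A₁ A₂) :=
  a.unitApp (B.obj (G₁.obj A₁) (G₂.obj A₂)) ≫ G.map (c.component (G₁.obj A₁) (G₂.obj A₂)).inv ≫
    G.map (B.tensor (a₁.counitApp A₁) (a₂.counitApp A₂))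

/-- The mate `F (A₁ ⊠ A₂) ⟶ F₁ A₁ ⊠ F₂ A₂` of a monoidality isomorphism. -/
noncomputable def leftMateApp (m : B.MonoidalityIso G₁ G₂ G) (A₁ : H.fib X₁) (A₂ : H.fib X₂) :
    F.obj (B.obj A₁ A₂) ⟶ B.obj (F₁.obj A₁) (F₂.obj A₂) :=
  F.map (B.tensor (a₁.unitApp A₁) (a₂.unitApp A₂)) ≫
    F.map (m.component (F₁.obj A₁) (F₂.obj A₂)).hom ≫
      a.counitApp (B.obj (F₁.obj A₁) (F₂.obj A₂))

variable {a₁ a₂ a}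

theorem IsMate.right_eq {c : B.MonoidalityIso F₁ F₂ F} {m : B.MonoidalityIso G₁ G₂ G}
    (h : IsMate a₁ a₂ a c m) (A₁ : H.fib Z₁) (A₂ : H.fib Z₂) :
    (m.component A₁ A₂).hom = c.rightMateApp a₁ a₂ a A₁ A₂ := by
  rw [rightMateApp, ← Functor.map_comp, ← h A₁ A₂, Functor.map_comp,
    ← reassoc_of% a.unitApp_naturality, Adjunction.unitApp_map_counitApp, Category.comp_id]

/-- The triangle identities undo the counits in the mate relation. Together with `right_eq`, this
shows that each member of a mate pair determines the other. -/
theorem IsMate.left_eq {c : B.MonoidalityIso F₁ F₂ F} {m : B.MonoidalityIso G₁ G₂ G}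
    (h : IsMate a₁ a₂ a c m) (A₁ : H.fib X₁) (A₂ : H.fib X₂) :
    (c.component A₁ A₂).inv = m.leftMateApp a₁ a₂ a A₁ A₂ := by
  rw [leftMateApp, h, reassoc_of% c.component_inv_naturality, ← B.tensor_comp,
    Adjunction.map_unitApp_counitApp, Adjunction.map_unitApp_counitApp, B.tensor_id,
    Category.comp_id]

theorem rightMateApp_naturality (c : B.MonoidalityIso F₁ F₂ F) {A₁ A₁' : H.fib Z₁}
    {A₂ A₂' : H.fib Z₂} (φ₁ : A₁ ⟶ A₁') (φ₂ : A₂ ⟶ A₂') :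
    B.tensor (G₁.map φ₁) (G₂.map φ₂) ≫ c.rightMateApp a₁ a₂ a A₁' A₂' =
      c.rightMateApp a₁ a₂ a A₁ A₂ ≫ G.map (B.tensor φ₁ φ₂) := by
  simp only [rightMateApp, Category.assoc]
  rw [reassoc_of% a.unitApp_naturality, ← Functor.map_comp_assoc, component_inv_naturality]
  simp only [← Functor.map_comp, Category.assoc, ← tensor_comp, Adjunction.counitApp_naturality]

theorem leftMateApp_naturality (m : B.MonoidalityIso G₁ G₂ G) {A₁ A₁' : H.fib X₁}
    {A₂ A₂' : H.fib X₂} (φ₁ : A₁ ⟶ A₁') (φ₂ : A₂ ⟶ A₂') :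
    F.map (B.tensor φ₁ φ₂) ≫ m.leftMateApp a₁ a₂ a A₁' A₂' =
      m.leftMateApp a₁ a₂ a A₁ A₂ ≫ B.tensor (F₁.map φ₁) (F₂.map φ₂) := by
  simp only [leftMateApp, Category.assoc]
  rw [← Adjunction.counitApp_naturality, ← Functor.map_comp_assoc, ← tensor_comp,
    Adjunction.unitApp_naturality, Adjunction.unitApp_naturality, tensor_comp,
    ← Functor.map_comp_assoc, Category.assoc, component_naturality]
  simp only [Functor.map_comp, Category.assoc]

variable (a₁ a₂ a)

/-- The mate of a monoidality isomorphism, when it is invertible. -/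
noncomputable def rightMateIso (c : B.MonoidalityIso F₁ F₂ F)
    (h : ∀ A₁ A₂, IsIso (c.rightMateApp a₁ a₂ a A₁ A₂)) : B.MonoidalityIso G₁ G₂ G :=
  ofComponents (fun A₁ A₂ => asIso (c.rightMateApp a₁ a₂ a A₁ A₂))
    (fun φ₁ φ₂ => rightMateApp_naturality c φ₁ φ₂)

/-- The inverse mate of a monoidality isomorphism, when it is invertible. -/
noncomputable def leftMateIso (m : B.MonoidalityIso G₁ G₂ G)
    (h : ∀ A₁ A₂, IsIso (m.leftMateApp a₁ a₂ a A₁ A₂)) : B.MonoidalityIso F₁ F₂ F :=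
  ofComponents (fun A₁ A₂ => (asIso (m.leftMateApp a₁ a₂ a A₁ A₂)).symm)
    (fun φ₁ φ₂ => by
      rw [Iso.symm_hom, Iso.symm_hom, Iso.comp_inv_eq, Category.assoc, Iso.eq_inv_comp]
      exact (leftMateApp_naturality m φ₁ φ₂).symm)

theorem isMate_rightMateIso (c : B.MonoidalityIso F₁ F₂ F)
    (h : ∀ A₁ A₂, IsIso (c.rightMateApp a₁ a₂ a A₁ A₂)) :
    IsMate a₁ a₂ a c (c.rightMateIso a₁ a₂ a h) := by
  intro A₁ A₂
  simp only [rightMateIso, ofComponents_component, asIso_hom, rightMateApp, Functor.map_comp,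
    Category.assoc]
  rw [a.counitApp_naturality, reassoc_of% a.counitApp_naturality,
    reassoc_of% a.map_unitApp_counitApp]

theorem isMate_leftMateIso (m : B.MonoidalityIso G₁ G₂ G)
    (h : ∀ A₁ A₂, IsIso (m.leftMateApp a₁ a₂ a A₁ A₂)) :
    IsMate a₁ a₂ a (m.leftMateIso a₁ a₂ a h) m := by
  intro A₁ A₂
  simp only [leftMateIso, ofComponents_component, Iso.symm_inv, asIso_hom, leftMateApp,
    Category.assoc]
  rw [← Adjunction.counitApp_naturality, ← Functor.map_comp_assoc, ← Functor.map_comp_assoc,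
    Category.assoc, ← component_naturality, ← reassoc_of% B.tensor_comp,
    Adjunction.unitApp_map_counitApp, Adjunction.unitApp_map_counitApp, tensor_id,
    Category.id_comp]

variable {a₁ a₂ a}

section shift

variable [F₁.CommShift ℤ] [F₂.CommShift ℤ] [F.CommShift ℤ] [G₁.CommShift ℤ] [G₂.CommShift ℤ]
  [G.CommShift ℤ] [a₁.CommShift ℤ] [a₂.CommShift ℤ] [a.CommShift ℤ]

/-- With one variable fixed, `m` is the mate, in the moving variable, of the inverse of `c` followed
by the counit of the fixed one. -/
theorem IsMate.triangulated_right {c : B.MonoidalityIso F₁ F₂ F} {m : B.MonoidalityIso G₁ G₂ G}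
    (h : IsMate a₁ a₂ a c m) (hc : c.Triangulated) : m.Triangulated where
  commShift_right A₁ := by
    have := hc.commShift_right (G₁.obj A₁)
    have : NatTrans.CommShift (F₁ := (B.box X₁ X₂).obj (G₁.obj A₁) ⋙ F)
        (F₂ := F₂ ⋙ (B.box Z₁ Z₂).obj (F₁.obj (G₁.obj A₁))) (c.inv.app (G₁.obj A₁)) ℤ :=
      NatTrans.CommShift.of_inverse (F := F₂ ⋙ (B.box Z₁ Z₂).obj (F₁.obj (G₁.obj A₁)))
        (G := (B.box X₁ X₂).obj (G₁.obj A₁) ⋙ F) (c.hom.app _) (c.inv.app _)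
        (c.hom_inv_id_app _) (c.inv_hom_id_app _)
    refine Adjunction.commShift_rightMate a₂ a
      ((by exact c.inv.app (G₁.obj A₁) : (B.box X₁ X₂).obj (G₁.obj A₁) ⋙ F ⟶
          F₂ ⋙ (B.box Z₁ Z₂).obj (F₁.obj (G₁.obj A₁))) ≫
        Functor.whiskerLeft F₂ ((B.box Z₁ Z₂).map (a₁.counit.app A₁))) _ fun A₂ => ?_
    refine (h.right_eq A₁ A₂).trans ?_
    simp [rightMateApp, component, tensor_eq_map, Adjunction.unitApp, Adjunction.counitApp]
  commShift_left A₂ := by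
    have := hc.commShift_left (G₂.obj A₂)
    have : NatTrans.CommShift (F₁ := (B.box X₁ X₂).flip.obj (G₂.obj A₂) ⋙ F)
        (F₂ := F₁ ⋙ (B.box Z₁ Z₂).flip.obj (F₂.obj (G₂.obj A₂))) (c.inv.flipApp (G₂.obj A₂)) ℤ :=
      let e := ((flipFunctor _ _ _).mapIso c).app (G₂.obj A₂)
      NatTrans.CommShift.of_inverse (F := F₁ ⋙ (B.box Z₁ Z₂).flip.obj (F₂.obj (G₂.obj A₂)))
        (G := (B.box X₁ X₂).flip.obj (G₂.obj A₂) ⋙ F) (c.hom.flipApp _) (c.inv.flipApp _)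
        e.hom_inv_id e.inv_hom_id
    refine Adjunction.commShift_rightMate a₁ a
      ((by exact c.inv.flipApp (G₂.obj A₂) : (B.box X₁ X₂).flip.obj (G₂.obj A₂) ⋙ F ⟶
          F₁ ⋙ (B.box Z₁ Z₂).flip.obj (F₂.obj (G₂.obj A₂))) ≫
        Functor.whiskerLeft F₁ ((B.box Z₁ Z₂).flip.map (a₂.counit.app A₂))) _ fun A₁ => ?_
    refine (h.right_eq A₁ A₂).trans ?_
    rw [rightMateApp, tensor_eq_comp]
    simp [-NatTrans.naturality, component, Adjunction.unitApp, Adjunction.counitApp]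

theorem IsMate.triangulated_left {c : B.MonoidalityIso F₁ F₂ F} {m : B.MonoidalityIso G₁ G₂ G}
    (h : IsMate a₁ a₂ a c m) (hm : m.Triangulated) : c.Triangulated where
  commShift_right A₁ := by
    have := hm.commShift_right (F₁.obj A₁)
    have : NatTrans.CommShift (F₁ := (B.box X₁ X₂).obj A₁ ⋙ F)
        (F₂ := F₂ ⋙ (B.box Z₁ Z₂).obj (F₁.obj A₁)) (c.inv.app A₁) ℤ := by
      refine Adjunction.commShift_leftMate a₂ a _
        (Functor.whiskerLeft G₂ ((B.box X₁ X₂).map (a₁.unit.app A₁)) ≫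
          (by exact m.hom.app (F₁.obj A₁) : G₂ ⋙ (B.box X₁ X₂).obj (G₁.obj (F₁.obj A₁)) ⟶
            (B.box Z₁ Z₂).obj (F₁.obj A₁) ⋙ G)) fun A₂ => ?_
      refine (h.left_eq A₁ A₂).trans ?_
      rw [leftMateApp, tensor_eq_comp]
      simp [-NatTrans.naturality, component, Adjunction.unitApp, Adjunction.counitApp]
    exact NatTrans.CommShift.of_inverse (F := (B.box X₁ X₂).obj A₁ ⋙ F)
      (G := F₂ ⋙ (B.box Z₁ Z₂).obj (F₁.obj A₁)) (c.inv.app A₁) (c.hom.app A₁)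
      (c.inv_hom_id_app _) (c.hom_inv_id_app _)
  commShift_left A₂ := by
    have := hm.commShift_left (F₂.obj A₂)
    have : NatTrans.CommShift (F₁ := (B.box X₁ X₂).flip.obj A₂ ⋙ F)
        (F₂ := F₁ ⋙ (B.box Z₁ Z₂).flip.obj (F₂.obj A₂)) (c.inv.flipApp A₂) ℤ := by
      refine Adjunction.commShift_leftMate a₁ a _
        (Functor.whiskerLeft G₁ ((B.box X₁ X₂).flip.map (a₂.unit.app A₂)) ≫
          (by exact m.hom.flipApp (F₂.obj A₂) : G₁ ⋙ (B.box X₁ X₂).flip.obj (G₂.obj (F₂.obj A₂)) ⟶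
            (B.box Z₁ Z₂).flip.obj (F₂.obj A₂) ⋙ G)) fun A₁ => ?_
      refine (h.left_eq A₁ A₂).trans ?_
      simp [leftMateApp, component, tensor_eq_map, Adjunction.unitApp, Adjunction.counitApp]
    let e := ((flipFunctor _ _ _).mapIso c).app A₂
    exact NatTrans.CommShift.of_inverse (F := (B.box X₁ X₂).flip.obj A₂ ⋙ F)
      (G := F₁ ⋙ (B.box Z₁ Z₂).flip.obj (F₂.obj A₂)) (c.inv.flipApp A₂) (c.hom.flipApp A₂)
      e.inv_hom_id e.hom_inv_id

end shift

end mates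

end ExternalProduct.MonoidalityIso

/-! ### Transposes of the canonical maps of direct images -/

namespace RightAdjoints

variable {S : Type u} [Category.{v} S] {H : FiberedCategory.{v, u, w', w} S}
  {W : MorphismProperty S} (R : RightAdjoints H W)

/-- The components of the connection isomorphisms of direct images. -/
noncomputable def connApp {T X V : S} (f : T ⟶ X) (g : X ⟶ V) (k : T ⟶ V) (e : f ≫ g = k)
    (hf : W f) (hg : W g) (hk : W k) (A : H.fib T) :
    (R.right k hk).obj A ≅ (R.right g hg).obj ((R.right f hf).obj A) :=
  (R.conn f g k e hf hg hk).app A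

theorem connApp_counit {T X V : S} (f : T ⟶ X) (g : X ⟶ V) (k : T ⟶ V) (e : f ≫ g = k)
    (hf : W f) (hg : W g) (hk : W k) (A : H.fib T) :
    (H.pull f).map ((H.pull g).map (R.connApp f g k e hf hg hk A).hom) ≫
        (H.pull f).map ((R.adj g hg).counitApp ((R.right f hf).obj A)) ≫ (R.adj f hf).counitApp A =
      (H.connApp f g k e ((R.right k hk).obj A)).inv ≫ (R.adj k hk).counitApp A := by
  have h := conjugateEquiv_counit (R.adj k hk) ((R.adj g hg).comp (R.adj f hf))
    (H.conn f g k e).symm.hom A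
  rw [Adjunction.comp_counit_app] at h
  exact h

theorem baseChange_counit {P' P Z X : S} (z' : P' ⟶ P) (p' : P' ⟶ Z)
    (p : P ⟶ X) (z : Z ⟶ X) (e : z' ≫ p = p' ≫ z) (hz : W z) (hz' : W z') (A : H.fib Z) :
    (H.pull z').map (R.baseChange z' p' p z e hz hz' A) ≫
        (R.adj z' hz').counitApp ((H.pull p').obj A) =
      (H.connApp z' p (p' ≫ z) e ((R.right z hz).obj A)).inv ≫
        (H.connApp p' z (p' ≫ z) rfl ((R.right z hz).obj A)).hom ≫
          (H.pull p').map ((R.adj z hz).counitApp A) := by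
  have : R.baseChange z' p' p z e hz hz' A =
      (R.adj z' hz').unitApp ((H.pull p).obj ((R.right z hz).obj A)) ≫
        (R.right z' hz').map (((H.connApp z' p (p' ≫ z) e ((R.right z hz).obj A)).inv ≫
        (H.connApp p' z (p' ≫ z) rfl ((R.right z hz).obj A)).hom) ≫
          (H.pull p').map ((R.adj z hz).counitApp A)) := by
    rw [Functor.map_comp]; rfl
  rw [this, Functor.map_comp, Category.assoc, Adjunction.counitApp_naturality,
    reassoc_of% (R.adj z' hz').map_unitApp_counitApp, Category.assoc]

end RightAdjoints

/-! ### Transposing the axioms of a core -/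

namespace ExternalProduct.MonoidalityIso

variable {S : Type u} [Category.{v} S] [HasBinaryProducts S]
  {H : FiberedCategory.{v, u, w', w} S} [H.Triangulated] {B : ExternalProduct H}
  {W : MorphismProperty S} {R : RightAdjoints H W}

section comp

variable {T₁ X₁ V₁ T₂ X₂ V₂ : S} {f₁ : T₁ ⟶ X₁} {g₁ : X₁ ⟶ V₁} {k₁ : T₁ ⟶ V₁}
    {f₂ : T₂ ⟶ X₂} {g₂ : X₂ ⟶ V₂} {k₂ : T₂ ⟶ V₂} (e₁ : f₁ ≫ g₁ = k₁) (e₂ : f₂ ≫ g₂ = k₂)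
    {hf₁ : W f₁} {hg₁ : W g₁} {hk₁ : W k₁} {hf₂ : W f₂} {hg₂ : W g₂} {hk₂ : W k₂}
    {hf : W (prod.map f₁ f₂)} {hg : W (prod.map g₁ g₂)} {hk : W (prod.map k₁ k₂)}
    {cf : B.MonoidalityIso (H.pull f₁) (H.pull f₂) (H.pull (prod.map f₁ f₂))}
    {cg : B.MonoidalityIso (H.pull g₁) (H.pull g₂) (H.pull (prod.map g₁ g₂))}
    {ck : B.MonoidalityIso (H.pull k₁) (H.pull k₂) (H.pull (prod.map k₁ k₂))}
    {mf : B.MonoidalityIso (R.right f₁ hf₁) (R.right f₂ hf₂) (R.right (prod.map f₁ f₂) hf)}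
    {mg : B.MonoidalityIso (R.right g₁ hg₁) (R.right g₂ hg₂) (R.right (prod.map g₁ g₂) hg)}
    {mk : B.MonoidalityIso (R.right k₁ hk₁) (R.right k₂ hk₂) (R.right (prod.map k₁ k₂) hk)}
    (Mf : IsMate (R.adj f₁ hf₁) (R.adj f₂ hf₂) (R.adj _ hf) cf mf)
    (Mg : IsMate (R.adj g₁ hg₁) (R.adj g₂ hg₂) (R.adj _ hg) cg mg)
    (Mk : IsMate (R.adj k₁ hk₁) (R.adj k₂ hk₂) (R.adj _ hk) ck mk)

include Mf Mg Mk

/-- Transposing along both inverse images, the mate relations express one side through `ck` and the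
other through the composite of `cf` and `cg`. Transposition is injective, whence the equivalence. -/
theorem IsMate.comp_aux (A₁ : H.fib T₁) (A₂ : H.fib T₂) :
    (mk.component A₁ A₂).hom ≫ (R.connApp (prod.map f₁ f₂) (prod.map g₁ g₂) (prod.map k₁ k₂)
        (prodMap_comp e₁ e₂) hf hg hk (B.obj A₁ A₂)).hom =
      B.tensor (R.connApp f₁ g₁ k₁ e₁ hf₁ hg₁ hk₁ A₁).hom
          (R.connApp f₂ g₂ k₂ e₂ hf₂ hg₂ hk₂ A₂).hom ≫
        (mg.component ((R.right f₁ hf₁).obj A₁) ((R.right f₂ hf₂).obj A₂)).hom ≫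
          (R.right (prod.map g₁ g₂) hg).map (mf.component A₁ A₂).hom ↔
    (ck.component ((R.right k₁ hk₁).obj A₁) ((R.right k₂ hk₂).obj A₂)).inv ≫
        B.tensor ((R.adj k₁ hk₁).counitApp A₁) ((R.adj k₂ hk₂).counitApp A₂) =
      ((comp f₁ g₁ k₁ f₂ g₂ k₂ e₁ e₂ cf cg).component ((R.right k₁ hk₁).obj A₁)
        ((R.right k₂ hk₂).obj A₂)).inv ≫
        B.tensor ((R.adj k₁ hk₁).counitApp A₁) ((R.adj k₂ hk₂).counitApp A₂) := by
  have h₁ : (H.pull (prod.map f₁ f₂)).map ((H.pull (prod.map g₁ g₂)).map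
      ((mk.component A₁ A₂).hom ≫ (R.connApp (prod.map f₁ f₂) (prod.map g₁ g₂) (prod.map k₁ k₂)
        (prodMap_comp e₁ e₂) hf hg hk (B.obj A₁ A₂)).hom)) ≫
      (H.pull (prod.map f₁ f₂)).map ((R.adj _ hg).counitApp _) ≫ (R.adj _ hf).counitApp _ =
    (H.connApp (prod.map f₁ f₂) (prod.map g₁ g₂) (prod.map k₁ k₂) (prodMap_comp e₁ e₂) _).inv ≫
      (ck.component ((R.right k₁ hk₁).obj A₁) ((R.right k₂ hk₂).obj A₂)).inv ≫
        B.tensor ((R.adj k₁ hk₁).counitApp A₁) ((R.adj k₂ hk₂).counitApp A₂) := by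
    rw [Functor.map_comp, Functor.map_comp, Category.assoc, R.connApp_counit,
      reassoc_of% H.connApp_inv_naturality, Mk]
  have h₂ : (H.pull (prod.map f₁ f₂)).map ((H.pull (prod.map g₁ g₂)).map
      (B.tensor (R.connApp f₁ g₁ k₁ e₁ hf₁ hg₁ hk₁ A₁).hom
          (R.connApp f₂ g₂ k₂ e₂ hf₂ hg₂ hk₂ A₂).hom ≫
        (mg.component ((R.right f₁ hf₁).obj A₁) ((R.right f₂ hf₂).obj A₂)).hom ≫
          (R.right (prod.map g₁ g₂) hg).map (mf.component A₁ A₂).hom)) ≫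
      (H.pull (prod.map f₁ f₂)).map ((R.adj _ hg).counitApp _) ≫ (R.adj _ hf).counitApp _ =
    (H.connApp (prod.map f₁ f₂) (prod.map g₁ g₂) (prod.map k₁ k₂) (prodMap_comp e₁ e₂) _).inv ≫
      ((comp f₁ g₁ k₁ f₂ g₂ k₂ e₁ e₂ cf cg).component ((R.right k₁ hk₁).obj A₁)
        ((R.right k₂ hk₂).obj A₂)).inv ≫
        B.tensor ((R.adj k₁ hk₁).counitApp A₁) ((R.adj k₂ hk₂).counitApp A₂) := by
    rw [comp_component_inv]
    simp only [Category.assoc, Iso.inv_hom_id_assoc]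
    have a₁ := (H.pull (prod.map f₁ f₂)).congr_map (cg.component_inv_naturality
      (R.connApp f₁ g₁ k₁ e₁ hf₁ hg₁ hk₁ A₁).hom (R.connApp f₂ g₂ k₂ e₂ hf₂ hg₂ hk₂ A₂).hom)
    have a₂ := (H.pull (prod.map f₁ f₂)).congr_map (Mg ((R.right f₁ hf₁).obj A₁)
      ((R.right f₂ hf₂).obj A₂))
    have a₃ := (H.pull (prod.map f₁ f₂)).congr_map
      ((R.adj _ hg).counitApp_naturality (mf.component A₁ A₂).hom)
    simp only [Functor.map_comp] at a₁ a₂ a₃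
    rw [← B.tensor_comp, ← R.connApp_counit f₁ g₁ k₁ e₁ hf₁ hg₁ hk₁,
      ← R.connApp_counit f₂ g₂ k₂ e₂ hf₂ hg₂ hk₂, B.tensor_comp, B.tensor_comp,
      ← reassoc_of% cf.component_inv_naturality, ← reassoc_of% cf.component_inv_naturality,
      ← Mf, ← reassoc_of% a₁, ← reassoc_of% a₂, ← reassoc_of% a₃]
    simp only [Functor.map_comp, Category.assoc]
  constructor
  · intro h
    rw [h, h₂] at h₁
    exact ((cancel_epi _).1 h₁).symm
  · intro h
    rw [h, ← h₂] at h₁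
    rw [← Functor.map_comp_assoc] at h₁
    refine (R.adj _ hg).eq_of_map_comp_counitApp ((R.adj _ hf).eq_of_map_comp_counitApp ?_)
    simpa only [Functor.map_comp, Category.assoc] using h₁

theorem IsMate.comp_right (h : ck = comp f₁ g₁ k₁ f₂ g₂ k₂ e₁ e₂ cf cg)
    (A₁ : H.fib T₁) (A₂ : H.fib T₂) :
    (mk.component A₁ A₂).hom ≫ (R.connApp (prod.map f₁ f₂) (prod.map g₁ g₂) (prod.map k₁ k₂)
        (prodMap_comp e₁ e₂) hf hg hk (B.obj A₁ A₂)).hom =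
      B.tensor (R.connApp f₁ g₁ k₁ e₁ hf₁ hg₁ hk₁ A₁).hom
          (R.connApp f₂ g₂ k₂ e₂ hf₂ hg₂ hk₂ A₂).hom ≫
        (mg.component ((R.right f₁ hf₁).obj A₁) ((R.right f₂ hf₂).obj A₂)).hom ≫
          (R.right (prod.map g₁ g₂) hg).map (mf.component A₁ A₂).hom :=
  (comp_aux e₁ e₂ Mf Mg Mk A₁ A₂).2 (by rw [h])

/-- By `comp_aux` the composite of `cf` and `cg` is another mate of `mk`, and `left_eq` leaves room
for only one. -/
theorem IsMate.comp_left (h : ∀ (A₁ : H.fib T₁) (A₂ : H.fib T₂),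
    (mk.component A₁ A₂).hom ≫ (R.connApp (prod.map f₁ f₂) (prod.map g₁ g₂) (prod.map k₁ k₂)
        (prodMap_comp e₁ e₂) hf hg hk (B.obj A₁ A₂)).hom =
      B.tensor (R.connApp f₁ g₁ k₁ e₁ hf₁ hg₁ hk₁ A₁).hom
          (R.connApp f₂ g₂ k₂ e₂ hf₂ hg₂ hk₂ A₂).hom ≫
        (mg.component ((R.right f₁ hf₁).obj A₁) ((R.right f₂ hf₂).obj A₂)).hom ≫
          (R.right (prod.map g₁ g₂) hg).map (mf.component A₁ A₂).hom) :
    ck = comp f₁ g₁ k₁ f₂ g₂ k₂ e₁ e₂ cf cg := by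
  have key : IsMate (R.adj k₁ hk₁) (R.adj k₂ hk₂) (R.adj _ hk) (comp f₁ g₁ k₁ f₂ g₂ k₂ e₁ e₂ cf cg)
      mk := fun A₁ A₂ => (Mk A₁ A₂).trans ((comp_aux e₁ e₂ Mf Mg Mk A₁ A₂).1 (h A₁ A₂))
  exact ext_component_inv fun A₁ A₂ => (Mk.left_eq A₁ A₂).trans (key.left_eq A₁ A₂).symm

end comp

section exchange

variable {P₁' P₁ Z₁ X₁ P₂' P₂ Z₂ X₂ : S}
    {z₁' : P₁' ⟶ P₁} {p₁' : P₁' ⟶ Z₁} {p₁ : P₁ ⟶ X₁} {z₁ : Z₁ ⟶ X₁}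
    {z₂' : P₂' ⟶ P₂} {p₂' : P₂' ⟶ Z₂} {p₂ : P₂ ⟶ X₂} {z₂ : Z₂ ⟶ X₂}
    (e₁ : z₁' ≫ p₁ = p₁' ≫ z₁) (e₂ : z₂' ≫ p₂ = p₂' ≫ z₂)
    (e : prod.map z₁' z₂' ≫ prod.map p₁ p₂ = prod.map p₁' p₂' ≫ prod.map z₁ z₂)
    {hz₁ : W z₁} {hz₁' : W z₁'} {hz₂ : W z₂} {hz₂' : W z₂'}
    {hz : W (prod.map z₁ z₂)} {hz' : W (prod.map z₁' z₂')}
    (s : B.MonoidalityIso (H.pull p₁) (H.pull p₂) (H.pull (prod.map p₁ p₂)))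
    (s' : B.MonoidalityIso (H.pull p₁') (H.pull p₂') (H.pull (prod.map p₁' p₂')))
    {c : B.MonoidalityIso (H.pull z₁) (H.pull z₂) (H.pull (prod.map z₁ z₂))}
    {c' : B.MonoidalityIso (H.pull z₁') (H.pull z₂') (H.pull (prod.map z₁' z₂'))}
    {m : B.MonoidalityIso (R.right z₁ hz₁) (R.right z₂ hz₂) (R.right (prod.map z₁ z₂) hz)}
    {m' : B.MonoidalityIso (R.right z₁' hz₁') (R.right z₂' hz₂') (R.right (prod.map z₁' z₂') hz')}
    (M : IsMate (R.adj z₁ hz₁) (R.adj z₂ hz₂) (R.adj _ hz) c m)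
    (M' : IsMate (R.adj z₁' hz₁') (R.adj z₂' hz₂') (R.adj _ hz') c' m')

/-- Moving isomorphisms across gives an equality of two maps `(z₁' × z₂')^*(p₁^* A₁ ⊠ p₂^* A₂) ⟶
(p₁' × p₂')^*(z₁^* A₁ ⊠ z₂^* A₂)`, the shape in which transposition produces the exchange axiom. -/
theorem comp_eq_comp_iff_component (A₁ : H.fib X₁) (A₂ : H.fib X₂) :
    ((comp z₁' p₁ (p₁' ≫ z₁) z₂' p₂ (p₂' ≫ z₂) e₁ e₂ c' s).component A₁ A₂).inv =
        ((comp p₁' z₁ (p₁' ≫ z₁) p₂' z₂ (p₂' ≫ z₂) rfl rfl s' c).component A₁ A₂).inv ↔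
      (H.pull (prod.map z₁' z₂')).map (s.component A₁ A₂).hom ≫
        (H.connApp _ _ _ e (B.obj A₁ A₂)).inv ≫ (H.connApp _ _ _ rfl (B.obj A₁ A₂)).hom ≫
        (H.pull (prod.map p₁' p₂')).map (c.component A₁ A₂).inv =
      (c'.component ((H.pull p₁).obj A₁) ((H.pull p₂).obj A₂)).inv ≫
        B.tensor ((H.connApp z₁' p₁ (p₁' ≫ z₁) e₁ A₁).inv ≫ (H.connApp p₁' z₁ _ rfl A₁).hom)
          ((H.connApp z₂' p₂ (p₂' ≫ z₂) e₂ A₂).inv ≫ (H.connApp p₂' z₂ _ rfl A₂).hom) ≫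
        (s'.component ((H.pull z₁).obj A₁) ((H.pull z₂).obj A₂)).hom := by
  have aux {C : Type w} [Category.{w'} C] {K X₁ X₂ Y₁ Y₂ U₁ U₂ T : C} (α : K ≅ X₁) (σ : U₁ ≅ X₁)
      (γ' : U₂ ≅ U₁) (τ₁ : T ≅ U₂) (β : K ≅ Y₁) (γ : Y₂ ≅ Y₁) (σ' : X₂ ≅ Y₂) (τ₂ : T ≅ X₂) :
      α.hom ≫ σ.inv ≫ γ'.inv ≫ τ₁.inv = β.hom ≫ γ.inv ≫ σ'.inv ≫ τ₂.inv ↔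
        σ.hom ≫ (α.inv ≫ β.hom) ≫ γ.inv = γ'.inv ≫ (τ₁.inv ≫ τ₂.hom) ≫ σ'.hom := by
    rw [← Iso.eq_inv_comp, Iso.inv_comp_eq σ]
    simp only [Category.assoc]
    constructor
    · intro h
      rw [reassoc_of% h]
      simp
    · intro h
      rw [← cancel_mono τ₂.hom, ← cancel_mono σ'.hom]
      simp [← h]
  rw [comp_component_inv, comp_component_inv, B.tensor_comp]
  have := aux (H.connApp _ _ _ (prodMap_comp e₁ e₂) (B.obj A₁ A₂))
    ((H.pull (prod.map z₁' z₂')).mapIso (s.component A₁ A₂)) (c'.component _ _)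
    (B.tensorIso (H.connApp z₁' p₁ (p₁' ≫ z₁) e₁ A₁) (H.connApp z₂' p₂ (p₂' ≫ z₂) e₂ A₂))
    (H.connApp _ _ _ (prodMap_comp rfl rfl) (B.obj A₁ A₂))
    ((H.pull (prod.map p₁' p₂')).mapIso (c.component A₁ A₂)) (s'.component _ _)
    (B.tensorIso (H.connApp p₁' z₁ (p₁' ≫ z₁) rfl A₁) (H.connApp p₂' z₂ (p₂' ≫ z₂) rfl A₂))
  rw [H.connApp_inv_hom_eq _ _ _ _ _ _ _ _ e rfl] at this
  simpa only [Functor.mapIso_hom, Functor.mapIso_inv, tensorIso_hom, tensorIso_inv,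
    Category.assoc] using this

theorem exchange_naturality {A₁ A₁' : H.fib X₁} {A₂ A₂' : H.fib X₂} (φ₁ : A₁ ⟶ A₁') (φ₂ : A₂ ⟶ A₂') :
    (H.pull (prod.map z₁' z₂')).map (B.tensor ((H.pull p₁).map φ₁) ((H.pull p₂).map φ₂)) ≫
      (H.pull (prod.map z₁' z₂')).map (s.component A₁' A₂').hom ≫
        (H.connApp _ _ _ e (B.obj A₁' A₂')).inv ≫ (H.connApp _ _ _ rfl (B.obj A₁' A₂')).hom ≫
        (H.pull (prod.map p₁' p₂')).map (c.component A₁' A₂').inv =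
    ((H.pull (prod.map z₁' z₂')).map (s.component A₁ A₂).hom ≫
        (H.connApp _ _ _ e (B.obj A₁ A₂)).inv ≫ (H.connApp _ _ _ rfl (B.obj A₁ A₂)).hom ≫
        (H.pull (prod.map p₁' p₂')).map (c.component A₁ A₂).inv) ≫
      (H.pull (prod.map p₁' p₂')).map (B.tensor ((H.pull z₁).map φ₁) ((H.pull z₂).map φ₂)) := by
  rw [← Functor.map_comp_assoc, s.component_naturality, Functor.map_comp_assoc,
    reassoc_of% H.connApp_inv_naturality, reassoc_of% H.connApp_hom_naturality,
    ← Functor.map_comp, c.component_inv_naturality]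
  simp only [Functor.map_comp, Category.assoc]

theorem exchange_naturality' {A₁ A₁' : H.fib X₁} {A₂ A₂' : H.fib X₂} (φ₁ : A₁ ⟶ A₁')
    (φ₂ : A₂ ⟶ A₂') :
    (H.pull (prod.map z₁' z₂')).map (B.tensor ((H.pull p₁).map φ₁) ((H.pull p₂).map φ₂)) ≫
      (c'.component ((H.pull p₁).obj A₁') ((H.pull p₂).obj A₂')).inv ≫
        B.tensor ((H.connApp z₁' p₁ (p₁' ≫ z₁) e₁ A₁').inv ≫ (H.connApp p₁' z₁ _ rfl A₁').hom)
          ((H.connApp z₂' p₂ (p₂' ≫ z₂) e₂ A₂').inv ≫ (H.connApp p₂' z₂ _ rfl A₂').hom) ≫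
        (s'.component ((H.pull z₁).obj A₁') ((H.pull z₂).obj A₂')).hom =
    ((c'.component ((H.pull p₁).obj A₁) ((H.pull p₂).obj A₂)).inv ≫
        B.tensor ((H.connApp z₁' p₁ (p₁' ≫ z₁) e₁ A₁).inv ≫ (H.connApp p₁' z₁ _ rfl A₁).hom)
          ((H.connApp z₂' p₂ (p₂' ≫ z₂) e₂ A₂).inv ≫ (H.connApp p₂' z₂ _ rfl A₂).hom) ≫
        (s'.component ((H.pull z₁).obj A₁) ((H.pull z₂).obj A₂)).hom) ≫
      (H.pull (prod.map p₁' p₂')).map (B.tensor ((H.pull z₁).map φ₁) ((H.pull z₂).map φ₂)) := by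
  rw [reassoc_of% c'.component_inv_naturality, ← reassoc_of% B.tensor_comp,
    reassoc_of% H.connApp_inv_naturality, reassoc_of% H.connApp_inv_naturality,
    H.connApp_hom_naturality, H.connApp_hom_naturality, Category.assoc, Category.assoc,
    ← s'.component_naturality, ← reassoc_of% B.tensor_comp, Category.assoc, Category.assoc]

include M M'

/-- The transpose of the exchange axiom along `z₁' × z₂'` is the equation of
`comp_eq_comp_iff_component`, but only at direct images and followed by the counits. -/
theorem IsMate.exchange_aux (A₁ : H.fib Z₁) (A₂ : H.fib Z₂) :
    (s.component ((R.right z₁ hz₁).obj A₁) ((R.right z₂ hz₂).obj A₂)).hom ≫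
        (H.pull (prod.map p₁ p₂)).map (m.component A₁ A₂).hom ≫
          R.baseChange (prod.map z₁' z₂') (prod.map p₁' p₂') (prod.map p₁ p₂) (prod.map z₁ z₂)
            e hz hz' (B.obj A₁ A₂) =
      B.tensor (R.baseChange z₁' p₁' p₁ z₁ e₁ hz₁ hz₁' A₁)
          (R.baseChange z₂' p₂' p₂ z₂ e₂ hz₂ hz₂' A₂) ≫
        (m'.component ((H.pull p₁').obj A₁) ((H.pull p₂').obj A₂)).hom ≫
          (R.right (prod.map z₁' z₂') hz').map (s'.component A₁ A₂).hom ↔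
    ((H.pull (prod.map z₁' z₂')).map (s.component ((R.right z₁ hz₁).obj A₁) ((R.right z₂ hz₂).obj A₂)).hom ≫
        (H.connApp _ _ _ e (B.obj _ _)).inv ≫ (H.connApp _ _ _ rfl (B.obj _ _)).hom ≫
        (H.pull (prod.map p₁' p₂')).map (c.component _ _).inv) ≫
        (H.pull (prod.map p₁' p₂')).map
          (B.tensor ((R.adj z₁ hz₁).counitApp A₁) ((R.adj z₂ hz₂).counitApp A₂)) =
      ((c'.component _ _).inv ≫
        B.tensor ((H.connApp z₁' p₁ (p₁' ≫ z₁) e₁ _).inv ≫ (H.connApp p₁' z₁ _ rfl _).hom)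
          ((H.connApp z₂' p₂ (p₂' ≫ z₂) e₂ _).inv ≫ (H.connApp p₂' z₂ _ rfl _).hom) ≫
        (s'.component ((H.pull z₁).obj _) ((H.pull z₂).obj _)).hom) ≫
        (H.pull (prod.map p₁' p₂')).map
          (B.tensor ((R.adj z₁ hz₁).counitApp A₁) ((R.adj z₂ hz₂).counitApp A₂)) := by
  have h₁ : (H.pull (prod.map z₁' z₂')).map
      ((s.component ((R.right z₁ hz₁).obj A₁) ((R.right z₂ hz₂).obj A₂)).hom ≫
        (H.pull (prod.map p₁ p₂)).map (m.component A₁ A₂).hom ≫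
          R.baseChange (prod.map z₁' z₂') (prod.map p₁' p₂') (prod.map p₁ p₂) (prod.map z₁ z₂)
            e hz hz' (B.obj A₁ A₂)) ≫ (R.adj _ hz').counitApp _ =
      ((H.pull (prod.map z₁' z₂')).map (s.component ((R.right z₁ hz₁).obj A₁) ((R.right z₂ hz₂).obj A₂)).hom ≫
        (H.connApp _ _ _ e (B.obj _ _)).inv ≫ (H.connApp _ _ _ rfl (B.obj _ _)).hom ≫
        (H.pull (prod.map p₁' p₂')).map (c.component _ _).inv) ≫
        (H.pull (prod.map p₁' p₂')).map
          (B.tensor ((R.adj z₁ hz₁).counitApp A₁) ((R.adj z₂ hz₂).counitApp A₂)) := by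
    rw [Functor.map_comp, Functor.map_comp, Category.assoc, Category.assoc, R.baseChange_counit,
      reassoc_of% H.connApp_inv_naturality, reassoc_of% H.connApp_hom_naturality,
      ← Functor.map_comp, M]
    simp only [Functor.map_comp, Category.assoc]
  have h₂ : (H.pull (prod.map z₁' z₂')).map
      (B.tensor (R.baseChange z₁' p₁' p₁ z₁ e₁ hz₁ hz₁' A₁)
          (R.baseChange z₂' p₂' p₂ z₂ e₂ hz₂ hz₂' A₂) ≫
        (m'.component ((H.pull p₁').obj A₁) ((H.pull p₂').obj A₂)).hom ≫
          (R.right (prod.map z₁' z₂') hz').map (s'.component A₁ A₂).hom) ≫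
            (R.adj _ hz').counitApp _ =
      ((c'.component _ _).inv ≫
        B.tensor ((H.connApp z₁' p₁ (p₁' ≫ z₁) e₁ _).inv ≫ (H.connApp p₁' z₁ _ rfl _).hom)
          ((H.connApp z₂' p₂ (p₂' ≫ z₂) e₂ _).inv ≫ (H.connApp p₂' z₂ _ rfl _).hom) ≫
        (s'.component ((H.pull z₁).obj _) ((H.pull z₂).obj _)).hom) ≫
        (H.pull (prod.map p₁' p₂')).map
          (B.tensor ((R.adj z₁ hz₁).counitApp A₁) ((R.adj z₂ hz₂).counitApp A₂)) := by
    rw [Functor.map_comp, Functor.map_comp, Category.assoc, Category.assoc,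
      Adjunction.counitApp_naturality, reassoc_of% M', reassoc_of% c'.component_inv_naturality,
      ← reassoc_of% B.tensor_comp, R.baseChange_counit, R.baseChange_counit, Category.assoc,
      Category.assoc, ← s'.component_naturality, ← reassoc_of% B.tensor_comp]
    simp only [Category.assoc]
  rw [← h₁, ← h₂]
  exact ⟨fun h => by rw [h], fun h => (R.adj _ hz').eq_of_map_comp_counitApp h⟩

theorem IsMate.exchange_right
    (h : comp z₁' p₁ (p₁' ≫ z₁) z₂' p₂ (p₂' ≫ z₂) e₁ e₂ c' s =
      comp p₁' z₁ (p₁' ≫ z₁) p₂' z₂ (p₂' ≫ z₂) rfl rfl s' c)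
    (A₁ : H.fib Z₁) (A₂ : H.fib Z₂) :
    (s.component ((R.right z₁ hz₁).obj A₁) ((R.right z₂ hz₂).obj A₂)).hom ≫
        (H.pull (prod.map p₁ p₂)).map (m.component A₁ A₂).hom ≫
          R.baseChange (prod.map z₁' z₂') (prod.map p₁' p₂') (prod.map p₁ p₂) (prod.map z₁ z₂)
            e hz hz' (B.obj A₁ A₂) =
      B.tensor (R.baseChange z₁' p₁' p₁ z₁ e₁ hz₁ hz₁' A₁)
          (R.baseChange z₂' p₂' p₂ z₂ e₂ hz₂ hz₂' A₂) ≫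
        (m'.component ((H.pull p₁').obj A₁) ((H.pull p₂').obj A₂)).hom ≫
          (R.right (prod.map z₁' z₂') hz').map (s'.component A₁ A₂).hom := by
  rw [exchange_aux e₁ e₂ e s s' M M']
  congr 1
  rw [← comp_eq_comp_iff_component e₁ e₂ e, h]

theorem IsMate.exchange_left
    (h : ∀ (A₁ : H.fib Z₁) (A₂ : H.fib Z₂),
      (s.component ((R.right z₁ hz₁).obj A₁) ((R.right z₂ hz₂).obj A₂)).hom ≫
        (H.pull (prod.map p₁ p₂)).map (m.component A₁ A₂).hom ≫
          R.baseChange (prod.map z₁' z₂') (prod.map p₁' p₂') (prod.map p₁ p₂) (prod.map z₁ z₂)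
            e hz hz' (B.obj A₁ A₂) =
      B.tensor (R.baseChange z₁' p₁' p₁ z₁ e₁ hz₁ hz₁' A₁)
          (R.baseChange z₂' p₂' p₂ z₂ e₂ hz₂ hz₂' A₂) ≫
        (m'.component ((H.pull p₁').obj A₁) ((H.pull p₂').obj A₂)).hom ≫
          (R.right (prod.map z₁' z₂') hz').map (s'.component A₁ A₂).hom) :
    comp z₁' p₁ (p₁' ≫ z₁) z₂' p₂ (p₂' ≫ z₂) e₁ e₂ c' s =
      comp p₁' z₁ (p₁' ≫ z₁) p₂' z₂ (p₂' ≫ z₂) rfl rfl s' c := by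
  refine ext_component_inv fun A₁ A₂ => ?_
  rw [comp_eq_comp_iff_component e₁ e₂ e]
  -- The hypothesis is used at `z₁^* A₁`, `z₂^* A₂`. Naturality along the units brings it back to
  -- `A₁`, `A₂`, where a triangle identity cancels the counits; full faithfulness of `z_*` is not
  -- needed.
  have h := (exchange_aux e₁ e₂ e s s' M M' ((H.pull z₁).obj A₁) ((H.pull z₂).obj A₂)).1 (h _ _)
  have aux {C : Type w} [Category.{w'} C] {K K' N N' : C} {x y : K ⟶ N} {x' y' : K' ⟶ N'}
      {a : K ⟶ K'} {b : N ⟶ N'} {d : N' ⟶ N} (hx : a ≫ x' = x ≫ b) (hy : a ≫ y' = y ≫ b)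
      (hbd : b ≫ d = 𝟙 N) (hd : x' ≫ d = y' ≫ d) : x = y := by
    rw [← Category.comp_id x, ← Category.comp_id y, ← hbd, ← reassoc_of% hx, ← reassoc_of% hy, hd]
  refine aux (exchange_naturality e s ((R.adj z₁ hz₁).unitApp A₁) ((R.adj z₂ hz₂).unitApp A₂))
    (exchange_naturality' e₁ e₂ s' ((R.adj z₁ hz₁).unitApp A₁) ((R.adj z₂ hz₂).unitApp A₂)) ?_ h
  rw [← Functor.map_comp, ← B.tensor_comp, Adjunction.map_unitApp_counitApp,
    Adjunction.map_unitApp_counitApp, tensor_id, CategoryTheory.Functor.map_id]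

end exchange

end ExternalProduct.MonoidalityIso

/-! ### Zero objects and open complements -/

theorem CategoryTheory.Adjunction.isZero_left_obj {C D : Type*} [Category C] [Category D]
    [HasZeroMorphisms D] {F : C ⥤ D} {G : D ⥤ C} (a : F ⊣ G) {X : C} (hX : IsZero X) :
    IsZero (F.obj X) :=
  (IsZero.iff_id_eq_zero _).2 ((a.homEquiv _ _).injective (hX.eq_of_src _ _))

section complement

variable {S : Type u} [Category.{v} S] [HasInitial S]

theorem IsOpenComplement.mono {Z X U : S} {z : Z ⟶ X} {u : U ⟶ X} (h : IsOpenComplement z u) :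
    Mono u := ⟨fun _ _ e => (h _).1 e⟩

theorem IsOpenComplement.isPullback {Z X U : S} {z : Z ⟶ X} {u : U ⟶ X}
    (h : IsOpenComplement z u) : IsPullback (initial.to U) (initial.to Z) u z :=
  ((h U).2 u).1 ⟨𝟙 U, Category.id_comp u⟩

/-- By pasting of Cartesian squares, `f` avoids `Z ⨯ Y` exactly when its first component avoids `Z`,
that is, factors through `U`. -/
theorem IsOpenComplement.prodMap_id [HasBinaryProducts S] {Z X U : S} {z : Z ⟶ X} {u : U ⟶ X}
    (h : IsOpenComplement z u) (Y : S) : IsOpenComplement (prod.map z (𝟙 Y)) (prod.map u (𝟙 Y)) := by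
  have := h.mono
  refine fun T => ⟨fun a b e => ?_, fun f => ?_⟩
  · exact (cancel_mono (prod.map u (𝟙 Y))).1 e
  · have h' : IsPullback (initial.to T) (initial.to (Z ⨯ Y)) f (prod.map z (𝟙 Y)) ↔
        IsPullback (initial.to T) (initial.to Z) (f ≫ prod.fst) z := by
      rw [IsPullback.flip_iff, ← (isPullback_prodMap_id z Y).paste_horiz_iff
        (Subsingleton.elim _ _), Subsingleton.elim (initial.to _ ≫ _) (initial.to Z),
        IsPullback.flip_iff]
    rw [h', ← (h T).2]
    constructor
    · rintro ⟨a, rfl⟩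
      exact ⟨a ≫ prod.fst, by simp⟩
    · rintro ⟨a, ha⟩
      exact ⟨prod.lift a (f ≫ prod.snd), by
        apply Limits.prod.hom_ext <;> simp only [prod.lift_map, prod.lift_fst, prod.lift_snd, ha,
          Category.comp_id]⟩

theorem IsOpenComplement.id_prodMap [HasBinaryProducts S] {Z X U : S} {z : Z ⟶ X} {u : U ⟶ X}
    (h : IsOpenComplement z u) (Y : S) : IsOpenComplement (prod.map (𝟙 Y) z) (prod.map (𝟙 Y) u) := by
  have := h.mono
  refine fun T => ⟨fun a b e => ?_, fun f => ?_⟩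
  · exact (cancel_mono (prod.map (𝟙 Y) u)).1 e
  · have h' : IsPullback (initial.to T) (initial.to (Y ⨯ Z)) f (prod.map (𝟙 Y) z) ↔
        IsPullback (initial.to T) (initial.to Z) (f ≫ prod.snd) z := by
      rw [IsPullback.flip_iff, ← (isPullback_id_prodMap z Y).paste_horiz_iff
        (Subsingleton.elim _ _), Subsingleton.elim (initial.to _ ≫ _) (initial.to Z),
        IsPullback.flip_iff]
    rw [h', ← (h T).2]
    constructor
    · rintro ⟨a, rfl⟩
      exact ⟨a ≫ prod.snd, by simp⟩
    · rintro ⟨a, ha⟩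
      exact ⟨prod.lift (f ≫ prod.fst) a, by
        apply Limits.prod.hom_ext <;> simp only [prod.lift_map, prod.lift_fst, prod.lift_snd, ha,
          Category.comp_id]⟩

end complement

/-! ### Localization along a closed immersion and its complement -/

namespace LeftAdjoints

variable {S : Type u} [Category.{v} S] {H : FiberedCategory.{v, u, w', w} S}
  {W : MorphismProperty S} (L : LeftAdjoints H W)

theorem isIso_counit_id {X : S} (h : W (𝟙 X)) (A : H.fib X) :
    IsIso ((L.adj (𝟙 X) h).counitApp A) := by
  have : (H.pull (𝟙 X)).Faithful := Functor.Faithful.of_iso (H.pullId X).symm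
  have : (H.pull (𝟙 X)).Full := Functor.Full.of_iso (H.pullId X).symm
  exact inferInstanceAs (IsIso ((L.adj (𝟙 X) h).counit.app A))

theorem baseChange_id {U X : S} (u : U ⟶ X) (hu : W u) (h : W (𝟙 U)) (A : H.fib U) :
    L.baseChange (𝟙 U) (𝟙 U) u u rfl hu h A =
      (L.adj (𝟙 U) h).counitApp A ≫ (L.adj u hu).unitApp A := by
  rw [← Adjunction.counitApp_naturality]
  have : (H.conn (𝟙 U) u (𝟙 U ≫ u) rfl).inv.app ((L.left u hu).obj A) ≫
      (H.conn (𝟙 U) u (𝟙 U ≫ u) rfl).hom.app ((L.left u hu).obj A) = 𝟙 _ :=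
    (H.conn _ _ _ _).inv_hom_id_app _
  simp [baseChange, this, Adjunction.counitApp, Adjunction.unitApp]

end LeftAdjoints

namespace IsLocalic

variable {S : Type u} [Category.{v} S] [HasBinaryProducts S] [HasInitial S]
  {D : LocalicBase S} {H : FiberedCategory.{v, u, w', w} S} [H.Triangulated]
  {L : LeftAdjoints H D.sm} {R : RightAdjoints H D.cl} (hH : IsLocalic D H L R)

include hH

/-- Base change rewrites `z^* u_#` as a left adjoint applied to an object over `∅`. -/
theorem isZero_pull_left {Z X U : S} {z : Z ⟶ X} {u : U ⟶ X} (h : IsOpenComplement z u)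
    (hu : D.sm u) (A : H.fib U) : IsZero ((H.pull z).obj ((L.left u hu).obj A)) := by
  have hp := D.sm_of_isPullback h.isPullback hu
  have := hH.isIso_baseChange h.isPullback hu hp A
  exact ((L.adj _ hp).isZero_left_obj (hH.isZero _)).of_iso
    (asIso (L.baseChange _ _ _ _ h.isPullback.w hu hp A)).symm

/-- By two adjunctions the identity of `u^* z_* A` corresponds to a map out of `z^* u_# u^* z_* A`,
which is zero. -/
theorem isZero_pull_right {Z X U : S} {z : Z ⟶ X} {u : U ⟶ X} (h : IsOpenComplement z u)
    (hz : D.cl z) (hu : D.sm u) (A : H.fib Z) :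
    IsZero ((H.pull u).obj ((R.right z hz).obj A)) :=
  (IsZero.iff_id_eq_zero _).2 (((L.adj u hu).homEquiv _ _).symm.injective
    (((R.adj z hz).homEquiv _ _).symm.injective
      ((hH.isZero_pull_left h hu _).eq_of_src _ _)))

theorem isIso_right_counit {Z X : S} (z : Z ⟶ X) (hz : D.cl z) (A : H.fib Z) :
    IsIso ((R.adj z hz).counitApp A) := by
  have := hH.full z hz
  have := hH.faithful z hz
  exact inferInstanceAs (IsIso ((R.adj z hz).counit.app A))

theorem isIso_pull_right_unit {Z X : S} (z : Z ⟶ X) (hz : D.cl z) (A : H.fib X) :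
    IsIso ((H.pull z).map ((R.adj z hz).unitApp A)) := by
  have := hH.isIso_right_counit z hz ((H.pull z).obj A)
  have h : IsIso ((H.pull z).map ((R.adj z hz).unitApp A) ≫
      (R.adj z hz).counitApp ((H.pull z).obj A)) := by
    rw [Adjunction.map_unitApp_counitApp]; infer_instance
  exact IsIso.of_isIso_comp_right _ ((R.adj z hz).counitApp ((H.pull z).obj A))

/-- For a monomorphism the kernel pair is trivial, so `baseChange_id` computes an invertible base
change map; its counit factor is invertible, hence so is the unit. -/
theorem isIso_left_unit {U X : S} (u : U ⟶ X) [Mono u] (hu : D.sm u) (A : H.fib U) :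
    IsIso ((L.adj u hu).unitApp A) := by
  have h := D.sm_of_isIso (𝟙 U)
  have := hH.isIso_baseChange (IsKernelPair.id_of_mono u) hu h A
  rw [L.baseChange_id u hu h A] at this
  have := L.isIso_counit_id h A
  exact IsIso.of_isIso_comp_left ((L.adj (𝟙 U) h).counitApp A) _

/-- On `Z` both sides vanish, and on `U` the counit is inverse to the unit. This and
`isIso_right_unit` play the role of the localization triangles. -/
theorem isIso_left_counit {Z X U : S} {z : Z ⟶ X} {u : U ⟶ X} (h : IsOpenComplement z u)
    (hz : D.cl z) (hu : D.sm u) {A : H.fib X} (hA : IsZero ((H.pull z).obj A)) :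
    IsIso ((L.adj u hu).counitApp A) := by
  have := h.mono
  refine hH.conservative z u hz hu h _ ((hH.isZero_pull_left h hu _).isIso hA _) ?_
  have := hH.isIso_left_unit u hu ((H.pull u).obj A)
  have h' : IsIso ((L.adj u hu).unitApp ((H.pull u).obj A) ≫
      (H.pull u).map ((L.adj u hu).counitApp A)) := by
    rw [Adjunction.unitApp_map_counitApp]; infer_instance
  exact IsIso.of_isIso_comp_left ((L.adj u hu).unitApp ((H.pull u).obj A)) _

theorem isIso_right_unit {Z X U : S} {z : Z ⟶ X} {u : U ⟶ X} (h : IsOpenComplement z u)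
    (hz : D.cl z) (hu : D.sm u) {A : H.fib X} (hA : IsZero ((H.pull u).obj A)) :
    IsIso ((R.adj z hz).unitApp A) :=
  hH.conservative z u hz hu h _ (hH.isIso_pull_right_unit z hz A)
    (hA.isIso (hH.isZero_pull_right h hz hu _) _)

end IsLocalic

/-! ### Invertibility of the mates -/

section invertibility

variable {S : Type u} [Category.{v} S] [HasBinaryProducts S]
  {H : FiberedCategory.{v, u, w', w} S} [H.Triangulated] {B : ExternalProduct H}

theorem ExternalProduct.isZero_obj_left {X₁ X₂ : S} {A₁ : H.fib X₁} (h : IsZero A₁)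
    (A₂ : H.fib X₂) : IsZero (B.obj A₁ A₂) :=
  ((B.box X₁ X₂).flip.obj A₂).map_isZero h

theorem ExternalProduct.isZero_obj_right {X₁ X₂ : S} (A₁ : H.fib X₁) {A₂ : H.fib X₂}
    (h : IsZero A₂) : IsZero (B.obj A₁ A₂) :=
  ((B.box X₁ X₂).obj A₁).map_isZero h

end invertibility

theorem FiberedCategory.isIso_pull_map_of_comp {S : Type u} [Category.{v} S]
    (H : FiberedCategory.{v, u, w', w} S) {T X V : S} (f : T ⟶ X) (g : X ⟶ V) (k : T ⟶ V)
    (e : f ≫ g = k) {A A' : H.fib V} (φ : A ⟶ A') (h : IsIso ((H.pull g).map φ)) :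
    IsIso ((H.pull k).map φ) := by
  have h' : IsIso ((H.pull k).map φ ≫ (H.connApp f g k e A').hom) := by
    rw [H.connApp_hom_naturality]
    infer_instance
  exact IsIso.of_isIso_comp_right _ (H.connApp f g k e A').hom

-- A triangulated functor inverts a morphism exactly when it kills the cone.
open Pretriangulated in
theorem CategoryTheory.Functor.isIso_map_of_isZero_map {C D D' : Type*} [Category C] [Category D]
    [Category D'] [HasZeroObject C] [HasShift C ℤ] [Preadditive C]
    [∀ n : ℤ, (shiftFunctor C n).Additive] [Pretriangulated C]
    [HasZeroObject D] [HasShift D ℤ] [Preadditive D]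
    [∀ n : ℤ, (shiftFunctor D n).Additive] [Pretriangulated D]
    [HasZeroObject D'] [HasShift D' ℤ] [Preadditive D']
    [∀ n : ℤ, (shiftFunctor D' n).Additive] [Pretriangulated D']
    (F : C ⥤ D) [F.CommShift ℤ] [F.IsTriangulated] (G : C ⥤ D') [G.CommShift ℤ] [G.IsTriangulated]
    (h : ∀ X, IsZero (F.obj X) → IsZero (G.obj X)) {X Y : C} (φ : X ⟶ Y) (hφ : IsIso (F.map φ)) :
    IsIso (G.map φ) := by
  obtain ⟨Z, g, k, hT⟩ := distinguished_cocone_triangle φ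
  have h₁ := (Triangle.isZero₃_iff_isIso₁ _ (F.map_distinguished _ hT)).2 hφ
  exact (Triangle.isZero₃_iff_isIso₁ _ (G.map_distinguished _ hT)).1 (h _ h₁)

namespace IsLocalic

variable {S : Type u} [Category.{v} S] [HasBinaryProducts S] [HasInitial S]
  {D : LocalicBase S} {H : FiberedCategory.{v, u, w', w} S} [H.Triangulated]
  {L : LeftAdjoints H D.sm} {R : RightAdjoints H D.cl} (hH : IsLocalic D H L R)
  {B : ExternalProduct H}

include hH

theorem isIso_unitApp_of_iso {Z X : S} (z : Z ⟶ X) (hz : D.cl z) {A : H.fib X} {A' : H.fib Z}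
    (e : A ≅ (R.right z hz).obj A') : IsIso ((R.adj z hz).unitApp A) := by
  have := hH.full z hz
  have := hH.faithful z hz
  exact (R.adj z hz).isIso_unit_app_of_iso e

section right

variable (E : ExternalTensorStructure B (⊤ : MorphismProperty S))

include E

/-- The complement of `Z₁ ⨯ Z₂` is not a product in general, so the factors are treated in turn. The
object `N` vanishes on `X₁ ⨯ U₂`, and its restriction to `X₁ ⨯ Z₂` vanishes on `U₁ ⨯ Z₂`, because
`m` moves restrictions inside `⊠` and `u^* z_* = 0`. Hence `N` lies in the essential image of the
fully faithful `(z₁ × z₂)_*`, where the unit is invertible. -/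
theorem isIso_right_unit_tensor {Z₁ X₁ Z₂ X₂ : S} (z₁ : Z₁ ⟶ X₁) (z₂ : Z₂ ⟶ X₂)
    (h₁ : D.cl z₁) (h₂ : D.cl z₂) (A₁ : H.fib Z₁) (A₂ : H.fib Z₂) :
    IsIso ((R.adj (prod.map z₁ z₂) (D.cl_prod z₁ z₂ h₁ h₂)).unitApp
      (B.obj ((R.right z₁ h₁).obj A₁) ((R.right z₂ h₂).obj A₂))) := by
  obtain ⟨U₁, u₁, hu₁, c₁⟩ := D.exists_complement z₁ h₁
  obtain ⟨U₂, u₂, hu₂, c₂⟩ := D.exists_complement z₂ h₂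
  have ha := D.cl_prod (𝟙 X₁) z₂ (D.cl_of_isIso _) h₂
  have hb := D.cl_prod z₁ (𝟙 Z₂) h₁ (D.cl_of_isIso _)
  let N := B.obj ((R.right z₁ h₁).obj A₁) ((R.right z₂ h₂).obj A₂)
  have := hH.isIso_right_unit (c₂.id_prodMap X₁) ha (D.sm_prod _ _ (D.sm_of_isIso _) hu₂)
    (A := N) ((B.isZero_obj_right _ (hH.isZero_pull_right c₂ h₂ hu₂ A₂)).of_iso
      ((E.m (𝟙 X₁) u₂ trivial trivial).component _ _).symm)
  have := hH.isIso_right_unit (c₁.prodMap_id Z₂) hb (D.sm_prod _ _ hu₁ (D.sm_of_isIso _))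
    (A := (H.pull (prod.map (𝟙 X₁) z₂)).obj N)
    ((B.isZero_obj_left (hH.isZero_pull_right c₁ h₁ hu₁ A₁) _).of_iso
      ((H.pull _).mapIso (((E.m (𝟙 X₁) z₂ trivial trivial).component _ _).symm ≪≫
        B.tensorIso ((H.pullId X₁).app _) (Iso.refl _)) ≪≫
        ((E.m u₁ (𝟙 Z₂) trivial trivial).component _ _).symm))
  exact hH.isIso_unitApp_of_iso _ _ (asIso ((R.adj _ ha).unitApp N) ≪≫
    (R.right _ ha).mapIso (asIso ((R.adj _ hb).unitApp _)) ≪≫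
    (R.connApp (prod.map z₁ (𝟙 Z₂)) (prod.map (𝟙 X₁) z₂) (prod.map z₁ z₂) (by simp) hb ha
      (D.cl_prod z₁ z₂ h₁ h₂) _).symm)

theorem isIso_rightMateApp {Z₁ X₁ Z₂ X₂ : S} (z₁ : Z₁ ⟶ X₁) (z₂ : Z₂ ⟶ X₂)
    (h₁ : D.cl z₁) (h₂ : D.cl z₂) (A₁ : H.fib Z₁) (A₂ : H.fib Z₂) :
    IsIso ((E.m z₁ z₂ trivial trivial).rightMateApp (R.adj z₁ h₁) (R.adj z₂ h₂)
      (R.adj (prod.map z₁ z₂) (D.cl_prod z₁ z₂ h₁ h₂)) A₁ A₂) := by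
  have := hH.isIso_right_unit_tensor E z₁ z₂ h₁ h₂ A₁ A₂
  have := hH.isIso_right_counit z₁ h₁ A₁
  have := hH.isIso_right_counit z₂ h₂ A₂
  rw [ExternalProduct.MonoidalityIso.rightMateApp]
  infer_instance

end right

section left

variable {s : ExternalTensorStructure B D.sm} (hs : s.IsLeftAdjointable L D.sm_prod)

include hs

/-- Here no monoidality along `z` is available. Instead `A ≅ u_# u^* A`, so smooth-adjointability
puts `A ⊠ A'` in the image of `(u × 𝟙)_#`, which `(z × 𝟙)^*` kills. -/
theorem isZero_pull_prodMap_id {Z X : S} (z : Z ⟶ X) (hz : D.cl z) {A : H.fib X}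
    (hA : IsZero ((H.pull z).obj A)) {Y : S} (A' : H.fib Y) :
    IsZero ((H.pull (prod.map z (𝟙 Y))).obj (B.obj A A')) := by
  obtain ⟨U, u, hu, c⟩ := D.exists_complement z hz
  have h := D.sm_of_isIso (𝟙 Y)
  have := hH.isIso_left_counit c hz hu hA
  have := L.isIso_counit_id h A'
  have := hs u (𝟙 Y) hu h ((H.pull u).obj A) ((H.pull (𝟙 Y)).obj A')
  refine (hH.isZero_pull_left (c.prodMap_id Y) (D.sm_prod _ _ hu h)
    (B.obj ((H.pull u).obj A) ((H.pull (𝟙 Y)).obj A'))).of_iso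
    ((H.pull _).mapIso ?_)
  exact (asIso (B.tensor ((L.adj u hu).counitApp A) ((L.adj (𝟙 Y) h).counitApp A'))).symm ≪≫
    (@asIso _ _ _ _ _ this).symm

theorem isZero_pull_id_prodMap {Z X : S} (z : Z ⟶ X) (hz : D.cl z) {A : H.fib X}
    (hA : IsZero ((H.pull z).obj A)) {Y : S} (A' : H.fib Y) :
    IsZero ((H.pull (prod.map (𝟙 Y) z)).obj (B.obj A' A)) := by
  obtain ⟨U, u, hu, c⟩ := D.exists_complement z hz
  have h := D.sm_of_isIso (𝟙 Y)
  have := hH.isIso_left_counit c hz hu hA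
  have := L.isIso_counit_id h A'
  have := hs (𝟙 Y) u h hu ((H.pull (𝟙 Y)).obj A') ((H.pull u).obj A)
  refine (hH.isZero_pull_left (c.id_prodMap Y) (D.sm_prod _ _ h hu)
    (B.obj ((H.pull (𝟙 Y)).obj A') ((H.pull u).obj A))).of_iso
    ((H.pull _).mapIso ?_)
  exact (asIso (B.tensor ((L.adj (𝟙 Y) h).counitApp A') ((L.adj u hu).counitApp A))).symm ≪≫
    (@asIso _ _ _ _ _ this).symm

/-- One variable at a time: `⊠` is triangulated in each variable, so the claim passes to cones,
where it is the vanishing just proved for `z₁ × 𝟙` and `𝟙 × z₂`. Restricting further to `Z₁ ⨯ Z₂`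
preserves isomorphisms. -/
theorem isIso_pull_tensor {Z₁ X₁ Z₂ X₂ : S} (z₁ : Z₁ ⟶ X₁) (z₂ : Z₂ ⟶ X₂)
    (h₁ : D.cl z₁) (h₂ : D.cl z₂) {A₁ A₁' : H.fib X₁} {A₂ A₂' : H.fib X₂} (φ₁ : A₁ ⟶ A₁')
    (φ₂ : A₂ ⟶ A₂') (hφ₁ : IsIso ((H.pull z₁).map φ₁)) (hφ₂ : IsIso ((H.pull z₂).map φ₂)) :
    IsIso ((H.pull (prod.map z₁ z₂)).map (B.tensor φ₁ φ₂)) := by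
  have i₁ : IsIso ((H.pull (prod.map z₁ z₂)).map (B.tensor φ₁ (𝟙 A₂))) := by
    refine H.isIso_pull_map_of_comp (prod.map (𝟙 Z₁) z₂) (prod.map z₁ (𝟙 X₂)) _ (by simp) _ ?_
    rw [B.tensor_id_right]
    exact Functor.isIso_map_of_isZero_map (H.pull z₁)
      ((B.box X₁ X₂).flip.obj A₂ ⋙ H.pull (prod.map z₁ (𝟙 X₂)))
      (fun _ h => hH.isZero_pull_prodMap_id hs z₁ h₁ h A₂) φ₁ hφ₁
  have i₂ : IsIso ((H.pull (prod.map z₁ z₂)).map (B.tensor (𝟙 A₁') φ₂)) := by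
    refine H.isIso_pull_map_of_comp (prod.map z₁ (𝟙 Z₂)) (prod.map (𝟙 X₁) z₂) _ (by simp) _ ?_
    rw [B.tensor_id_left]
    exact Functor.isIso_map_of_isZero_map (H.pull z₂)
      ((B.box X₁ X₂).obj A₁' ⋙ H.pull (prod.map (𝟙 X₁) z₂))
      (fun _ h => hH.isZero_pull_id_prodMap hs z₂ h₂ h A₁') φ₂ hφ₂
  have h : B.tensor φ₁ φ₂ = B.tensor φ₁ (𝟙 A₂) ≫ B.tensor (𝟙 A₁') φ₂ := by
    rw [← B.tensor_comp, Category.comp_id, Category.id_comp]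
  rw [h, Functor.map_comp]
  infer_instance

/-- The only factor that is not visibly invertible is the inverse image of the product of the two
units; each unit becomes invertible after `z₁^*` or `z₂^*`, so `isIso_pull_tensor` applies. -/
theorem isIso_leftMateApp {Z₁ X₁ Z₂ X₂ : S} (z₁ : Z₁ ⟶ X₁) (z₂ : Z₂ ⟶ X₂)
    (h₁ : D.cl z₁) (h₂ : D.cl z₂) (m : B.MonoidalityIso (R.right z₁ h₁) (R.right z₂ h₂)
      (R.right (prod.map z₁ z₂) (D.cl_prod z₁ z₂ h₁ h₂))) (A₁ : H.fib X₁) (A₂ : H.fib X₂) :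
    IsIso (m.leftMateApp (R.adj z₁ h₁) (R.adj z₂ h₂)
      (R.adj (prod.map z₁ z₂) (D.cl_prod z₁ z₂ h₁ h₂)) A₁ A₂) := by
  have := hH.isIso_pull_tensor hs z₁ z₂ h₁ h₂ _ _ (hH.isIso_pull_right_unit z₁ h₁ A₁)
    (hH.isIso_pull_right_unit z₂ h₂ A₂)
  have := hH.isIso_right_counit (prod.map z₁ z₂) (D.cl_prod z₁ z₂ h₁ h₂)
    (B.obj ((H.pull z₁).obj A₁) ((H.pull z₂).obj A₂))
  rw [ExternalProduct.MonoidalityIso.leftMateApp]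
  infer_instance

end left

end IsLocalic

/-! ### From localic structures to cores -/

section cores

open ExternalProduct.MonoidalityIso

variable {S : Type u} [Category.{v} S] [HasBinaryProducts S]
  {H : FiberedCategory.{v, u, w', w} S} [H.Triangulated] {B : ExternalProduct H}

theorem ExternalProduct.MonoidalityIso.eq_comp_iff {T₁ X₁ V₁ T₂ X₂ V₂ : S}
    {f₁ : T₁ ⟶ X₁} {g₁ : X₁ ⟶ V₁} {k₁ : T₁ ⟶ V₁} {f₂ : T₂ ⟶ X₂} {g₂ : X₂ ⟶ V₂} {k₂ : T₂ ⟶ V₂}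
    (e₁ : f₁ ≫ g₁ = k₁) (e₂ : f₂ ≫ g₂ = k₂)
    {κ : B.MonoidalityIso (H.pull k₁) (H.pull k₂) (H.pull (prod.map k₁ k₂))}
    {μ : B.MonoidalityIso (H.pull f₁) (H.pull f₂) (H.pull (prod.map f₁ f₂))}
    {ν : B.MonoidalityIso (H.pull g₁) (H.pull g₂) (H.pull (prod.map g₁ g₂))} :
    κ = comp f₁ g₁ k₁ f₂ g₂ k₂ e₁ e₂ μ ν ↔ ∀ (A₁ : H.fib V₁) (A₂ : H.fib V₂),
      (κ.component A₁ A₂).hom ≫ (H.connApp (prod.map f₁ f₂) (prod.map g₁ g₂) (prod.map k₁ k₂)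
          (prodMap_comp e₁ e₂) (B.obj A₁ A₂)).hom =
        B.tensor (H.connApp f₁ g₁ k₁ e₁ A₁).hom (H.connApp f₂ g₂ k₂ e₂ A₂).hom ≫
          (μ.component ((H.pull g₁).obj A₁) ((H.pull g₂).obj A₂)).hom ≫
            (H.pull (prod.map f₁ f₂)).map (ν.component A₁ A₂).hom := by
  constructor
  · rintro rfl A₁ A₂
    rw [comp_component_hom]
    simp
  · refine fun h => ext_component fun A₁ A₂ => ?_
    rw [comp_component_hom, ← Category.assoc, ← Category.assoc, Iso.eq_comp_inv, h]
    simp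

theorem ExternalTensorStructure.m_eq_comp {W : MorphismProperty S}
    (E : ExternalTensorStructure B W) {T₁ X₁ V₁ T₂ X₂ V₂ : S} (f₁ : T₁ ⟶ X₁) (g₁ : X₁ ⟶ V₁)
    (k₁ : T₁ ⟶ V₁) (f₂ : T₂ ⟶ X₂) (g₂ : X₂ ⟶ V₂) (k₂ : T₂ ⟶ V₂) (e₁ : f₁ ≫ g₁ = k₁)
    (e₂ : f₂ ≫ g₂ = k₂) (hf₁ : W f₁) (hg₁ : W g₁) (hk₁ : W k₁) (hf₂ : W f₂) (hg₂ : W g₂)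
    (hk₂ : W k₂) : E.m k₁ k₂ hk₁ hk₂ =
      comp f₁ g₁ k₁ f₂ g₂ k₂ e₁ e₂ (E.m f₁ f₂ hf₁ hf₂) (E.m g₁ g₂ hg₁ hg₂) :=
  (eq_comp_iff e₁ e₂).2 fun A₁ A₂ =>
    E.m_comp f₁ g₁ k₁ f₂ g₂ k₂ e₁ e₂ hf₁ hg₁ hk₁ hf₂ hg₂ hk₂ A₁ A₂

instance RightAdjoints.adj_commShift {W : MorphismProperty S} (R : RightAdjoints H W)
    {T X : S} (f : T ⟶ X) (hf : W f) : (R.adj f hf).CommShift ℤ :=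
  (R.adj f hf).commShift_of_leftAdjoint ℤ

/-- The triangle identity of a core, in terms of the monoidality isomorphism `c` along closed
immersions that is determined by direct images. -/
theorem ExternalProduct.MonoidalityIso.eq_comp_iff_triangle {Q₁ P₁ X₁ Q₂ P₂ X₂ : S}
    {h₁ : Q₁ ⟶ P₁} {p₁ : P₁ ⟶ X₁} {q₁ : Q₁ ⟶ X₁} {h₂ : Q₂ ⟶ P₂} {p₂ : P₂ ⟶ X₂} {q₂ : Q₂ ⟶ X₂}
    (e₁ : h₁ ≫ p₁ = q₁) (e₂ : h₂ ≫ p₂ = q₂)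
    {σ : B.MonoidalityIso (H.pull q₁) (H.pull q₂) (H.pull (prod.map q₁ q₂))}
    {c : B.MonoidalityIso (H.pull h₁) (H.pull h₂) (H.pull (prod.map h₁ h₂))}
    {s : B.MonoidalityIso (H.pull p₁) (H.pull p₂) (H.pull (prod.map p₁ p₂))} :
    σ = comp h₁ p₁ q₁ h₂ p₂ q₂ e₁ e₂ c s ↔ ∀ (A₁ : H.fib X₁) (A₂ : H.fib X₂),
      (H.connApp (prod.map h₁ h₂) (prod.map p₁ p₂) (prod.map q₁ q₂)
          (prodMap_comp e₁ e₂) (B.obj A₁ A₂)).inv ≫ (σ.component A₁ A₂).inv ≫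
          B.tensor (H.connApp h₁ p₁ q₁ e₁ A₁).hom (H.connApp h₂ p₂ q₂ e₂ A₂).hom =
      (H.pull (prod.map h₁ h₂)).map (s.component A₁ A₂).inv ≫
        (c.component ((H.pull p₁).obj A₁) ((H.pull p₂).obj A₂)).inv := by
  constructor
  · rintro rfl A₁ A₂
    rw [comp_component_inv]
    simp [← B.tensor_comp]
  · refine fun h => ext_component_inv fun A₁ A₂ => ?_
    rw [comp_component_inv, ← reassoc_of% h A₁ A₂, ← B.tensor_comp]
    simp

variable [HasInitial S] {D : LocalicBase S} {L : LeftAdjoints H D.sm} {R : RightAdjoints H D.cl}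

namespace LocalicTensorStructure

variable (hH : IsLocalic D H L R) (E : LocalicTensorStructure D B L)

/-- Both sides are the value of `m` at the diagonals of the squares, which need only commute. -/
theorem exchange_m {P₁' P₁ Z₁ X₁ P₂' P₂ Z₂ X₂ : S}
    {z₁' : P₁' ⟶ P₁} {p₁' : P₁' ⟶ Z₁} {p₁ : P₁ ⟶ X₁} {z₁ : Z₁ ⟶ X₁}
    {z₂' : P₂' ⟶ P₂} {p₂' : P₂' ⟶ Z₂} {p₂ : P₂ ⟶ X₂} {z₂ : Z₂ ⟶ X₂}
    (e₁ : z₁' ≫ p₁ = p₁' ≫ z₁) (e₂ : z₂' ≫ p₂ = p₂' ≫ z₂) :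
    comp z₁' p₁ (p₁' ≫ z₁) z₂' p₂ (p₂' ≫ z₂) e₁ e₂
        (E.toStr.m z₁' z₂' trivial trivial) (E.toStr.m p₁ p₂ trivial trivial) =
      comp p₁' z₁ (p₁' ≫ z₁) p₂' z₂ (p₂' ≫ z₂) rfl rfl
        (E.toStr.m p₁' p₂' trivial trivial) (E.toStr.m z₁ z₂ trivial trivial) :=
  (E.toStr.m_eq_comp z₁' p₁ (p₁' ≫ z₁) z₂' p₂ (p₂' ≫ z₂) e₁ e₂ trivial trivial trivial trivial
    trivial trivial).symm.trans (E.toStr.m_eq_comp _ _ _ _ _ _ rfl rfl trivial trivial trivial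
      trivial trivial trivial)

/-- The monoidality isomorphisms of direct images along closed immersions. -/
noncomputable def directImage {T₁ X₁ T₂ X₂ : S} (z₁ : T₁ ⟶ X₁) (z₂ : T₂ ⟶ X₂) (h₁ : D.cl z₁)
    (h₂ : D.cl z₂) : B.MonoidalityIso (R.right z₁ h₁) (R.right z₂ h₂)
      (R.right (prod.map z₁ z₂) (D.cl_prod z₁ z₂ h₁ h₂)) :=
  (E.toStr.m z₁ z₂ trivial trivial).rightMateIso _ _ _
    (hH.isIso_rightMateApp E.toStr z₁ z₂ h₁ h₂)

theorem isMate_directImage {T₁ X₁ T₂ X₂ : S} (z₁ : T₁ ⟶ X₁) (z₂ : T₂ ⟶ X₂) (h₁ : D.cl z₁)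
    (h₂ : D.cl z₂) : IsMate (R.adj z₁ h₁) (R.adj z₂ h₂)
      (R.adj (prod.map z₁ z₂) (D.cl_prod z₁ z₂ h₁ h₂)) (E.toStr.m z₁ z₂ trivial trivial)
      (E.directImage hH z₁ z₂ h₁ h₂) :=
  isMate_rightMateIso _ _ _ _ _

/-- The core of a localic external tensor structure. -/
noncomputable def core : ExternalTensorCore D B L R where
  sm := E.toStr.restrict le_top
  cl :=
    { m := E.directImage hH
      triangulated := fun z₁ z₂ h₁ h₂ => (E.isMate_directImage hH z₁ z₂ h₁ h₂).triangulated_right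
        (E.toStr.triangulated z₁ z₂ trivial trivial)
      m_comp := fun f₁ g₁ k₁ f₂ g₂ k₂ e₁ e₂ hf₁ hg₁ hk₁ hf₂ hg₂ hk₂ A₁ A₂ =>
        IsMate.comp_right e₁ e₂ (E.isMate_directImage hH f₁ f₂ hf₁ hf₂)
          (E.isMate_directImage hH g₁ g₂ hg₁ hg₂) (E.isMate_directImage hH k₁ k₂ hk₁ hk₂)
          (E.toStr.m_eq_comp f₁ g₁ k₁ f₂ g₂ k₂ e₁ e₂ trivial trivial trivial trivial trivial
            trivial) A₁ A₂ }
  smoothAdjointable := E.smoothAdjointable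
  exchange {P₁' P₁ Z₁ X₁ P₂' P₂ Z₂ X₂ z₁' p₁' p₁ z₁ z₂' p₂' p₂ z₂} sq₁ sq₂ hp₁ hz₁ hp₂ hz₂ A₁ A₂ :=
    IsMate.exchange_right sq₁.w sq₂.w (by rw [prod.map_map, prod.map_map, sq₁.w, sq₂.w]) _ _
      (E.isMate_directImage hH z₁ z₂ hz₁ hz₂)
      (E.isMate_directImage hH z₁' z₂' (D.cl_of_isPullback sq₁ hp₁ hz₁)
        (D.cl_of_isPullback sq₂ hp₂ hz₂)) (E.exchange_m sq₁.w sq₂.w) A₁ A₂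
  triangle h₁ p₁ q₁ e₁ h₂ p₂ q₂ e₂ hh₁ hp₁ hq₁ hh₂ hp₂ hq₂ A₁ A₂ := by
    refine ((eq_comp_iff_triangle e₁ e₂).1 (E.toStr.m_eq_comp h₁ p₁ q₁ h₂ p₂ q₂ e₁ e₂ trivial
      trivial trivial trivial trivial trivial) A₁ A₂).trans ?_
    -- The inverse of `m` along the closed immersions is recovered as the left mate of `m̄`.
    rw [(E.isMate_directImage hH h₁ h₂ hh₁ hh₂).left_eq]
    rfl

theorem core_isInducedBy : (E.core hH).IsInducedBy E where
  sm_eq := rfl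
  cl_eq _ _ _ _ _ _ := rfl

end LocalicTensorStructure

theorem ExternalTensorCore.IsInducedBy.core_unique {C C' : ExternalTensorCore D B L R}
    {E : LocalicTensorStructure D B L} (h : C.IsInducedBy E) (h' : C'.IsInducedBy E) : C = C' := by
  refine ExternalTensorCore.ext (h.sm_eq.trans h'.sm_eq.symm)
    (DirectImageTensorStructure.ext ?_)
  funext T₁ X₁ T₂ X₂ z₁ z₂ h₁ h₂
  exact ext_component fun A₁ A₂ =>
    (h.cl_eq z₁ z₂ h₁ h₂ A₁ A₂).trans (h'.cl_eq z₁ z₂ h₁ h₂ A₁ A₂).symm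

end cores

/-! ### From cores to localic structures -/

section cores

open ExternalProduct.MonoidalityIso

variable {S : Type u} [Category.{v} S] [HasBinaryProducts S]
  {H : FiberedCategory.{v, u, w', w} S} [H.Triangulated] {B : ExternalProduct H}

/-- The triangulated monoidality isomorphisms for `⊠`, as labels on pairs of morphisms. -/
noncomputable def ExternalProduct.labels (B : ExternalProduct H) : MorphismLabels (S × S) where
  Label f := { m : B.MonoidalityIso (H.pull f.1) (H.pull f.2) (H.pull (prod.map f.1 f.2)) //
    m.Triangulated }
  comp f g k e μ ν := ⟨comp f.1 g.1 k.1 f.2 g.2 k.2 (congrArg (·.1) e) (congrArg (·.2) e) μ.1 ν.1,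
    μ.2.comp _ _ _ _ ν.2⟩
  assoc f g h fg gh k _ _ _ _ μ ν ρ := Subtype.ext
    (comp_assoc f.1 g.1 h.1 fg.1 gh.1 k.1 f.2 g.2 h.2 fg.2 gh.2 k.2 _ _ _ _ _ _ _ _ μ.1 ν.1 ρ.1)

variable [HasInitial S] {D : LocalicBase S} {L : LeftAdjoints H D.sm} {R : RightAdjoints H D.cl}

namespace ExternalTensorCore

variable (hH : IsLocalic D H L R) (C : ExternalTensorCore D B L R)

/-- The monoidality isomorphisms of inverse images along closed immersions. -/
noncomputable def inverseImage {T₁ X₁ T₂ X₂ : S} (z₁ : T₁ ⟶ X₁) (z₂ : T₂ ⟶ X₂) (h₁ : D.cl z₁)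
    (h₂ : D.cl z₂) : B.MonoidalityIso (H.pull z₁) (H.pull z₂) (H.pull (prod.map z₁ z₂)) :=
  (C.cl.m z₁ z₂ h₁ h₂).leftMateIso _ _ _
    (hH.isIso_leftMateApp C.smoothAdjointable z₁ z₂ h₁ h₂ _)

theorem isMate_inverseImage {T₁ X₁ T₂ X₂ : S} (z₁ : T₁ ⟶ X₁) (z₂ : T₂ ⟶ X₂) (h₁ : D.cl z₁)
    (h₂ : D.cl z₂) : IsMate (R.adj z₁ h₁) (R.adj z₂ h₂)
      (R.adj (prod.map z₁ z₂) (D.cl_prod z₁ z₂ h₁ h₂)) (C.inverseImage hH z₁ z₂ h₁ h₂)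
      (C.cl.m z₁ z₂ h₁ h₂) :=
  isMate_leftMateIso _ _ _ _ _

theorem inverseImage_comp {T₁ X₁ V₁ T₂ X₂ V₂ : S} (f₁ : T₁ ⟶ X₁) (g₁ : X₁ ⟶ V₁)
    (k₁ : T₁ ⟶ V₁) (f₂ : T₂ ⟶ X₂) (g₂ : X₂ ⟶ V₂) (k₂ : T₂ ⟶ V₂) (e₁ : f₁ ≫ g₁ = k₁)
    (e₂ : f₂ ≫ g₂ = k₂) (hf₁ : D.cl f₁) (hg₁ : D.cl g₁) (hk₁ : D.cl k₁) (hf₂ : D.cl f₂)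
    (hg₂ : D.cl g₂) (hk₂ : D.cl k₂) : comp f₁ g₁ k₁ f₂ g₂ k₂ e₁ e₂
      (C.inverseImage hH f₁ f₂ hf₁ hf₂) (C.inverseImage hH g₁ g₂ hg₁ hg₂) =
        C.inverseImage hH k₁ k₂ hk₁ hk₂ :=
  (IsMate.comp_left e₁ e₂ (C.isMate_inverseImage hH f₁ f₂ hf₁ hf₂)
    (C.isMate_inverseImage hH g₁ g₂ hg₁ hg₂) (C.isMate_inverseImage hH k₁ k₂ hk₁ hk₂)
    fun A₁ A₂ => C.cl.m_comp f₁ g₁ k₁ f₂ g₂ k₂ e₁ e₂ hf₁ hg₁ hk₁ hf₂ hg₂ hk₂ A₁ A₂).symm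

theorem inverseImage_exchange {P₁' P₁ Z₁ X₁ P₂' P₂ Z₂ X₂ : S}
    {z₁' : P₁' ⟶ P₁} {p₁' : P₁' ⟶ Z₁} {p₁ : P₁ ⟶ X₁} {z₁ : Z₁ ⟶ X₁}
    {z₂' : P₂' ⟶ P₂} {p₂' : P₂' ⟶ Z₂} {p₂ : P₂ ⟶ X₂} {z₂ : Z₂ ⟶ X₂}
    (sq₁ : IsPullback z₁' p₁' p₁ z₁) (sq₂ : IsPullback z₂' p₂' p₂ z₂)
    (hp₁ : D.sm p₁) (hz₁ : D.cl z₁) (hp₂ : D.sm p₂) (hz₂ : D.cl z₂)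
    (hp₁' : D.sm p₁') (hz₁' : D.cl z₁') (hp₂' : D.sm p₂') (hz₂' : D.cl z₂') :
    comp z₁' p₁ (p₁' ≫ z₁) z₂' p₂ (p₂' ≫ z₂) sq₁.w sq₂.w
        (C.inverseImage hH z₁' z₂' hz₁' hz₂') (C.sm.m p₁ p₂ hp₁ hp₂) =
      comp p₁' z₁ (p₁' ≫ z₁) p₂' z₂ (p₂' ≫ z₂) rfl rfl
        (C.sm.m p₁' p₂' hp₁' hp₂') (C.inverseImage hH z₁ z₂ hz₁ hz₂) :=
  IsMate.exchange_left sq₁.w sq₂.w (by rw [prod.map_map, prod.map_map, sq₁.w, sq₂.w]) _ _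
    (C.isMate_inverseImage hH z₁ z₂ hz₁ hz₂) (C.isMate_inverseImage hH z₁' z₂' hz₁' hz₂')
    fun A₁ A₂ => C.exchange sq₁ sq₂ hp₁ hz₁ hp₂ hz₂ A₁ A₂

theorem inverseImage_triangle {Q₁ P₁ X₁ Q₂ P₂ X₂ : S}
    (h₁ : Q₁ ⟶ P₁) (p₁ : P₁ ⟶ X₁) (q₁ : Q₁ ⟶ X₁) (h₂ : Q₂ ⟶ P₂) (p₂ : P₂ ⟶ X₂) (q₂ : Q₂ ⟶ X₂)
    (e₁ : h₁ ≫ p₁ = q₁) (e₂ : h₂ ≫ p₂ = q₂) (hh₁ : D.cl h₁) (hp₁ : D.sm p₁) (hq₁ : D.sm q₁)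
    (hh₂ : D.cl h₂) (hp₂ : D.sm p₂) (hq₂ : D.sm q₂) :
    comp h₁ p₁ q₁ h₂ p₂ q₂ e₁ e₂ (C.inverseImage hH h₁ h₂ hh₁ hh₂) (C.sm.m p₁ p₂ hp₁ hp₂) =
      C.sm.m q₁ q₂ hq₁ hq₂ := by
  refine ((eq_comp_iff_triangle e₁ e₂).2 fun A₁ A₂ => ?_).symm
  rw [(C.isMate_inverseImage hH h₁ h₂ hh₁ hh₂).left_eq]
  exact C.triangle h₁ p₁ q₁ e₁ h₂ p₂ q₂ e₂ hh₁ hp₁ hq₁ hh₂ hp₂ hq₂ A₁ A₂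

/-- The monoidality isomorphisms of a core along closed immersions and along smooth morphisms. -/
noncomputable def gluingDatum : B.labels.GluingDatum (fun _ _ f => D.cl f.1 ∧ D.cl f.2)
    (fun _ _ f => D.sm f.1 ∧ D.sm f.2) where
  c f hf := ⟨C.inverseImage hH f.1 f.2 hf.1 hf.2,
    (C.isMate_inverseImage hH f.1 f.2 hf.1 hf.2).triangulated_left (C.cl.triangulated _ _ _ _)⟩
  s f hf := ⟨C.sm.m f.1 f.2 hf.1 hf.2, C.sm.triangulated _ _ _ _⟩
  c_comp f g k e hf hg hk := Subtype.ext
    (C.inverseImage_comp hH _ _ _ _ _ _ _ _ hf.1 hg.1 hk.1 hf.2 hg.2 hk.2)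
  s_comp f g k e hf hg hk := Subtype.ext
    (C.sm.m_eq_comp _ _ _ _ _ _ _ _ hf.1 hg.1 hk.1 hf.2 hg.2 hk.2).symm
  triangle h p q e hh hp hq := Subtype.ext
    (C.inverseImage_triangle hH _ _ _ _ _ _ _ _ hh.1 hp.1 hq.1 hh.2 hp.2 hq.2)
  sm_id X := ⟨D.sm_of_isIso (𝟙 X.1), D.sm_of_isIso (𝟙 X.2)⟩
  cl_id X := ⟨D.cl_of_isIso (𝟙 X.1), D.cl_of_isIso (𝟙 X.2)⟩
  -- Compatibility with composition makes the values at identities idempotent, hence neutral.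
  s_id_left f μ := Subtype.ext (idem_comp f.1 f.2 μ.1 _
    (C.sm.m_eq_comp _ _ _ _ _ _ _ _ _ _ _ _ _ _).symm)
  s_id_right f μ := Subtype.ext (comp_idem f.1 f.2 μ.1 _
    (C.sm.m_eq_comp _ _ _ _ _ _ _ _ _ _ _ _ _ _).symm)
  c_id_left f μ := Subtype.ext (idem_comp f.1 f.2 μ.1 _
    (C.inverseImage_comp hH _ _ _ _ _ _ _ _ _ _ _ _ _ _))
  cl_comp f g hf hg := ⟨D.cl_comp _ _ hf.1 hg.1, D.cl_comp _ _ hf.2 hg.2⟩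
  sm_comp f g hf hg := ⟨D.sm_comp _ _ hf.1 hg.1, D.sm_comp _ _ hf.2 hg.2⟩
  cl_of_comp f g h := ⟨D.cl_of_comp _ _ h.1, D.cl_of_comp _ _ h.2⟩
  factor f := by
    obtain ⟨P₁, t₁, p₁, ht₁, hp₁, e₁⟩ := D.factor f.1
    obtain ⟨P₂, t₂, p₂, ht₂, hp₂, e₂⟩ := D.factor f.2
    exact ⟨(P₁, P₂), (t₁, t₂), (p₁, p₂), ⟨ht₁, ht₂⟩, ⟨hp₁, hp₂⟩, Prod.ext e₁ e₂⟩
  exists_baseChange p f hp := by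
    have := D.hasPullback p.1 f.1 hp.1
    have := D.hasPullback p.2 f.2 hp.2
    have sq₁ := IsPullback.of_hasPullback p.1 f.1
    have sq₂ := IsPullback.of_hasPullback p.2 f.2
    have hp₁' := D.sm_of_isPullback sq₁ hp.1
    have hp₂' := D.sm_of_isPullback sq₂ hp.2
    refine ⟨(pullback p.1 f.1, pullback p.2 f.2), (pullback.fst p.1 f.1, pullback.fst p.2 f.2),
      (pullback.snd p.1 f.1, pullback.snd p.2 f.2), ⟨hp₁', hp₂'⟩, Prod.ext sq₁.w sq₂.w,
      fun a b e => ?_, fun hf => ⟨D.sm_of_isPullback sq₁.flip hf.1,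
        D.sm_of_isPullback sq₂.flip hf.2⟩, fun hf => ?_⟩
    · exact ⟨(sq₁.lift a.1 b.1 (congrArg (·.1) e), sq₂.lift a.2 b.2 (congrArg (·.2) e)),
        Prod.ext (sq₁.lift_fst _ _ _) (sq₂.lift_fst _ _ _),
        Prod.ext (sq₁.lift_snd _ _ _) (sq₂.lift_snd _ _ _)⟩
    · have hz₁' := D.cl_of_isPullback sq₁ hp.1 hf.1
      have hz₂' := D.cl_of_isPullback sq₂ hp.2 hf.2
      exact ⟨⟨hz₁', hz₂'⟩, Subtype.ext (C.inverseImage_exchange hH sq₁ sq₂ hp.1 hf.1 hp.2 hf.2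
        hp₁' hz₁' hp₂' hz₂')⟩

include hH

theorem exists_isInducedBy : ∃ E : LocalicTensorStructure D B L, C.IsInducedBy E := by
  obtain ⟨m, hcomp, hs, hc⟩ := (C.gluingDatum hH).exists_extension
  let E : ExternalTensorStructure B (⊤ : MorphismProperty S) :=
    { m := fun {T₁ X₁ T₂ X₂} f₁ f₂ _ _ => (m (T := (T₁, T₂)) (X := (X₁, X₂)) (f₁, f₂)).1
      triangulated := fun {T₁ X₁ T₂ X₂} f₁ f₂ _ _ =>
        (m (T := (T₁, T₂)) (X := (X₁, X₂)) (f₁, f₂)).2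
      m_comp := fun {T₁ X₁ V₁ T₂ X₂ V₂} f₁ g₁ k₁ f₂ g₂ k₂ e₁ e₂ _ _ _ _ _ _ A₁ A₂ =>
        (eq_comp_iff e₁ e₂).1 (congrArg Subtype.val
          (hcomp (T := (T₁, T₂)) (X := (X₁, X₂)) (V := (V₁, V₂)) (f₁, f₂) (g₁, g₂) (k₁, k₂)
            (Prod.ext e₁ e₂))) A₁ A₂ }
  -- Smooth-adjointability concerns only this restriction, so it is inherited from `C`.
  have hE : E.restrict le_top = C.sm := by
    refine ExternalTensorStructure.ext ?_
    funext T₁ X₁ T₂ X₂ f₁ f₂ h₁ h₂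
    exact congrArg Subtype.val (hs (T := (T₁, T₂)) (X := (X₁, X₂)) (f₁, f₂) ⟨h₁, h₂⟩)
  refine ⟨⟨E, hE ▸ C.smoothAdjointable⟩, hE.symm, fun {Z₁ X₁ Z₂ X₂} z₁ z₂ h₁ h₂ A₁ A₂ => ?_⟩
  have h : E.m z₁ z₂ trivial trivial = C.inverseImage hH z₁ z₂ h₁ h₂ :=
    congrArg Subtype.val (hc (T := (Z₁, Z₂)) (X := (X₁, X₂)) (z₁, z₂) ⟨h₁, h₂⟩)
  refine ((C.isMate_inverseImage hH z₁ z₂ h₁ h₂).right_eq A₁ A₂).trans ?_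
  rw [← h]
  rfl

variable {C}

/-- By uniqueness of the induced core, `C` is the core constructed from `E`, for which the relation
holds by construction. -/
theorem IsInducedBy.isMate {E : LocalicTensorStructure D B L} (h : C.IsInducedBy E)
    {T₁ X₁ T₂ X₂ : S} (z₁ : T₁ ⟶ X₁) (z₂ : T₂ ⟶ X₂) (h₁ : D.cl z₁) (h₂ : D.cl z₂) :
    IsMate (R.adj z₁ h₁) (R.adj z₂ h₂) (R.adj (prod.map z₁ z₂) (D.cl_prod z₁ z₂ h₁ h₂))
      (E.toStr.m z₁ z₂ trivial trivial) (C.cl.m z₁ z₂ h₁ h₂) := by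
  obtain rfl := h.core_unique (E.core_isInducedBy hH)
  exact E.isMate_directImage hH z₁ z₂ h₁ h₂

/-- After factoring both morphisms, the closed part of `m` is determined by its mate in `C.cl` and
the smooth part is given by `C.sm`. -/
theorem IsInducedBy.eq {E E' : LocalicTensorStructure D B L} (h : C.IsInducedBy E)
    (h' : C.IsInducedBy E') : E = E' := by
  refine LocalicTensorStructure.ext (ExternalTensorStructure.ext ?_)
  funext T₁ X₁ T₂ X₂ f₁ f₂ _ _
  obtain ⟨P₁, t₁, p₁, ht₁, hp₁, e₁⟩ := D.factor f₁
  obtain ⟨P₂, t₂, p₂, ht₂, hp₂, e₂⟩ := D.factor f₂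
  rw [E.toStr.m_eq_comp t₁ p₁ f₁ t₂ p₂ f₂ e₁ e₂ trivial trivial trivial trivial trivial trivial,
    E'.toStr.m_eq_comp t₁ p₁ f₁ t₂ p₂ f₂ e₁ e₂ trivial trivial trivial trivial trivial trivial]
  congr 1
  · exact ext_component_inv fun A₁ A₂ => ((h.isMate hH t₁ t₂ ht₁ ht₂).left_eq A₁ A₂).trans
      ((h'.isMate hH t₁ t₂ ht₁ ht₂).left_eq A₁ A₂).symm
  · exact congrArg (fun s : ExternalTensorStructure B D.sm => s.m p₁ p₂ hp₁ hp₂)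
      (h.sm_eq.symm.trans h'.sm_eq)

end ExternalTensorCore

end cores

/-! ### The correspondence -/

theorem mainTheorem4 {S : Type u} [Category.{v} S] [HasBinaryProducts S] [HasInitial S]
    (D : LocalicBase S) (H : FiberedCategory.{v, u, w', w} S) [H.Triangulated]
    (L : LeftAdjoints H D.sm) (R : RightAdjoints H D.cl) (hH : IsLocalic D H L R)
    (B : ExternalProduct H) :
    (∀ E : LocalicTensorStructure D B L, ∃! C : ExternalTensorCore D B L R, C.IsInducedBy E) ∧
      (∀ C : ExternalTensorCore D B L R, ∃! E : LocalicTensorStructure D B L,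
        C.IsInducedBy E) := by
  refine ⟨fun E => ⟨E.core hH, E.core_isInducedBy hH, fun C h =>
    h.core_unique (E.core_isInducedBy hH)⟩, fun C => ?_⟩
  obtain ⟨E, h⟩ := C.exists_isInducedBy hH
  exact ⟨E, h, fun E' h' => h'.eq hH h⟩
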